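/- Let $X_0,X_1,\dots$ be a stationary process on a probability space $(\Omega,\mathcal F,\mathbb P)$ with values in $[-\infty,\infty]$. For $n\ge 1$ let $u_n:[0,\infty)\to[-\infty,\infty]$ be continuous and strictly decreasing, such that almost surely every $X_j$ lies in the range of $u_n$, and such that $n\,\mathbb P(X_0>u_n(\tau))\to\tau$ as $n\to\infty$ for every $\tau>0$. Let $$N_n=\sum_{j=0}^\infty\delta_{(j/n,\;u_n^{-1}(X_j))},\qquad M_k=\max\{X_0,\dots,X_{k-1}\},\qquad Z_n(t)=u_n^{-1}\big(M_{\lfloor nt\rfloor+1}\big)\quad(t\ge 0).$$ $N_n$ is a random element of the space $M_p([0,\infty)^2)$ of Radon point measures on $[0,\infty)^2$ with the vague topology. Let $\theta\in(0,1]$ and let $\tilde N$ be a point process on $[0,\infty)^2$ of Mori–Hsing type with parameter $\theta$, i.e. almost surely $$\tilde N=\sum_{i,j=1}^\infty\sum_{\ell=1}^{K_{i,j}}\delta_{(T_{i,j},\,U_{i,j}Y_{i,j,\ell})},\qquad T_{i,j}=\sum_{l=1}^j\bar T_{i,l},$$ where the $\bar T_{i,j}$ are independent exponential variables of rate $\theta$;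 the $U_{i,j}$ are independent and $U_{i,j}$ is uniform on $(i-1,i]$; $\gamma_{i,j}=\sum_{\ell=1}^{K_{i,j}}\delta_{Y_{i,j,\ell}}$, with $K_{i,j}\in\{1,2,\dots\}\cup\{\infty\}$, are identically distributed (Radon) point processes on $[1,\infty)$, each having almost surely an atom at $1$; and the three arrays $(\bar T_{i,j})$, $(U_{i,j})$, $(\gamma_{i,j})$ are mutually independent. Let $\bar H(\tau)=e^{-\theta\tau}$ and let $Z_H=(Z_H(t))_{t\ge0}$ be a process with values in $[0,\infty]$ and right continuous paths with left limits such that, for all $k$, all $0\le t_1<\dots<t_k$ (put $t_0=0$) and all $y_1,\dots,y_k\ge0$, $$\mathbb P\big(Z_H(t_1)\ge y_1,\dots,Z_H(t_k)\ge y_k\big)=\prod_{i=1}^k\bar H\Big(\max_{i\le j\le k}y_j\Big)^{t_i-t_{i-1}} .$$ For a path $Z$ define its path inverse by $Z^{\leftarrow}(y)=\inf\{t\ge 0:Z(t)<y\}\in[0,\infty]$, $y\ge0$, with $\inf\emptyset=\infty$. It is nonincreasing, and it is regarded as an element of the space $\mathbb D([0,\infty))$ of right continuous functions with left limits from $[0,\infty)$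 to $[0,\infty]$ through its right continuous version $y\mapsto Z^{\leftarrow}(y+)$. Equip $\mathbb D([0,\infty))$ with Skorokhod's $M_1$ topology, where values in $[0,\infty]$ are compared by the metric $\left|\frac{x}{1+x}-\frac{y}{1+y}\right|$: for $T\ge 0$, $d_T(g,h)$ is the infimum, over all parametrizations $(\lambda_1,\gamma_1)$, $(\lambda_2,\gamma_2)$ of the completed graphs of $g$ and $h$ on $[0,T]$, of the larger of the uniform distance of $\lambda_1,\lambda_2$ and that of $\gamma_1,\gamma_2$; and the topology is that of the metric $\int_0^\infty e^{-t}\,(1\wedge d_t(g,h))\,dt$. If $N_n$ converges weakly to $\tilde N$ in $M_p([0,\infty)^2)$, then $Z_n^{\leftarrow}$ converges weakly to $Z_H^{\leftarrow}$ in $\mathbb D([0,\infty))$ with the $M_1$ topology. Moreover, almost surely $Z_H^{\leftarrow}(y)<\infty$ for every $y>0$. -/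

import Mathlib

open MeasureTheory ProbabilityTheory Filter Topology Set
open scoped ENNReal NNReal

noncomputable section

/-! ## Point processes -/

section PointMeasures

variable (E : Type*) [TopologicalSpace E] [MeasurableSpace E]

/-- The space `M_p(E)` of Radon point measures on `E`: countable (finite or infinite) sums of
Dirac masses that are finite on compact sets. -/
def PointMeasure : Type _ :=
  {m : Measure E //
    (∃ (s : Set ℕ) (x : ℕ → E), m = Measure.sum fun i : s => Measure.dirac (x i)) ∧
      ∀ K : Set E, IsCompact K → m K < ∞}

/-- The vague topology on `M_p(E)`: the coarsest topology for which `m ↦ ∫ f dm` is continuous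
for every continuous `f : E → ℝ` of compact support. -/
instance : TopologicalSpace (PointMeasure E) :=
  ⨅ f : CompactlySupportedContinuousMap E ℝ,
    TopologicalSpace.induced (fun m : PointMeasure E => ∫ x, f x ∂m.1) inferInstance

instance : MeasurableSpace (PointMeasure E) := borel _

instance : BorelSpace (PointMeasure E) := ⟨rfl⟩

end PointMeasures

/-- The point measure `∑_{j ≥ 0} δ_{(j/n, v_j)}` on `[0,∞)²`. -/
def timeMarkPointMeasure (n : ℕ+) (v : ℕ → ℝ≥0) : PointMeasure (ℝ≥0 × ℝ≥0) :=
  ⟨Measure.sum fun j : ℕ => Measure.dirac ((j : ℝ≥0) / (n : ℕ), v j), by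
    constructor
    · refine ⟨univ, fun j => ((j : ℝ≥0) / (n : ℕ), v j), ?_⟩
      ext A hA
      rw [Measure.sum_apply _ hA, Measure.sum_apply _ hA]
      exact ((Equiv.Set.univ ℕ).tsum_eq
        (fun j : ℕ => Measure.dirac ((j : ℝ≥0) / (n : ℕ), v j) A)).symm
    · intro K hK
      obtain ⟨T, hT⟩ := (hK.image continuous_fst).bddAbove
      have hn : (0 : ℝ≥0) < ((n : ℕ) : ℝ≥0) := by exact_mod_cast n.pos
      rw [Measure.sum_apply _ hK.measurableSet,
        tsum_eq_sum (s := Finset.range (⌊T * (n : ℕ)⌋₊ + 1))]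
      · exact ENNReal.sum_lt_top.2 fun j _ => measure_lt_top _ _
      · intro j hj
        rw [Measure.dirac_apply' _ hK.measurableSet, Set.indicator_of_notMem]
        intro hmem
        apply hj
        have h1 : (j : ℝ≥0) / (n : ℕ) ≤ T := hT ⟨_, hmem, rfl⟩
        rw [Finset.mem_range, Nat.lt_succ_iff]
        exact Nat.le_floor ((div_le_iff₀ hn).1 h1)⟩

/-- A point process on `[0,∞)²` of Mori–Hsing type with parameter `θ`: almost surely
`N = ∑_{i,j} ∑_ℓ δ_{(T_{i,j}, U_{i,j} Y_{i,j,ℓ})}`, where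
* `T_{i,j} = T̄_{i,1} + ⋯ + T̄_{i,j}` with `T̄_{i,j}` independent and exponential of rate `θ`;
* the `U_{i,j}` are independent and `U_{i,j}` is uniform on `(i-1,i]`;
* `γ_{i,j} = ∑_ℓ δ_{Y_{i,j,ℓ}}` are identically distributed point processes on `[1,∞)` that
  have `1` as an atom;
* the three arrays `(T̄_{i,j})`, `(U_{i,j})`, `(γ_{i,j})` are mutually independent.

The indices `i, j` start from `0` in the code, and the inner sum is the image of `γ_{i,j}` under
`y ↦ (T_{i,j}, U_{i,j} y)`. -/
def IsMoriHsing {Ω : Type*} [MeasurableSpace Ω] (θ : ℝ)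
    (N : Ω → PointMeasure (ℝ≥0 × ℝ≥0)) (P : Measure Ω) : Prop :=
  ∃ (Tbar U : ℕ × ℕ → Ω → ℝ≥0) (γ : ℕ × ℕ → Ω → PointMeasure (Ici (1 : ℝ≥0))),
    (∀ p, HasLaw (fun ω => (Tbar p ω : ℝ)) (expMeasure θ) P) ∧
    iIndepFun Tbar P ∧
    (∀ p, HasLaw (fun ω => (U p ω : ℝ))
      (volume.restrict (Ioc (p.1 : ℝ) ((p.1 : ℝ) + 1))) P) ∧
    iIndepFun U P ∧
    (∀ p q, IdentDistrib (γ p) (γ q) P P) ∧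
    (∀ p, ∀ᵐ ω ∂P, (γ p ω).1 {⟨1, self_mem_Ici⟩} ≠ 0) ∧
    IndepFun (fun ω p => Tbar p ω) (fun ω => ((fun p => U p ω), (fun p => γ p ω))) P ∧
    IndepFun (fun ω p => U p ω) (fun ω p => γ p ω) P ∧
    ∀ᵐ ω ∂P, (N ω).1 = Measure.sum fun p : ℕ × ℕ =>
      (γ p ω).1.map fun y : Ici (1 : ℝ≥0) =>
        (∑ l ∈ Finset.range (p.2 + 1), Tbar (p.1, l) ω, U p ω * (y : ℝ≥0))

/-! ## The Skorokhod space with the `M₁` topology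

Paths take values in `[0,∞]`, with its usual compact topology, because path inverses can take the
value `inf ∅ = ∞` (and limiting path inverses do so at `0`). -/

/-- The space `𝔻([0,∞))` of functions `[0,∞) → [0,∞]` that are right continuous and have left
limits. -/
def SkorokhodSpace : Type :=
  {g : ℝ≥0 → ℝ≥0∞ // ∀ t, ContinuousWithinAt g (Ici t) t ∧ ∃ l, Tendsto g (𝓝[<] t) (𝓝 l)}

/-- The distance `|x/(1+x) - y/(1+y)|` on `[0,∞]` (with `∞/(1+∞) = 1`), which induces the usual
topology of `[0,∞]`. -/
def extDist (x y : ℝ≥0∞) : ℝ :=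
  |(ENNReal.orderIsoUnitIntervalBirational x : ℝ) - ENNReal.orderIsoUnitIntervalBirational y|

/-- The completed graph of `g` on `[0,T]`. At `t = 0` the convention is `g(0-) = g(0)`. -/
def completedGraph (g : ℝ≥0 → ℝ≥0∞) (T : ℝ≥0) : Set (ℝ≥0 × ℝ≥0∞) :=
  {p | p.1 ≤ T ∧ p.2 ∈ uIcc (Function.leftLim g p.1) (g p.1)}

/-- A parametrization of the completed graph of `g` on `[0,T]`: a continuous map from `[0,1]`
onto the completed graph that is nondecreasing for the order which runs through the graph with
increasing time and, at a jump time `t`, from `g(t-)` to `g(t)`. -/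
structure GraphParam (g : ℝ≥0 → ℝ≥0∞) (T : ℝ≥0) where
  time : unitInterval → ℝ≥0
  space : unitInterval → ℝ≥0∞
  continuous_time : Continuous time
  continuous_space : Continuous space
  range_eq : range (fun s => (time s, space s)) = completedGraph g T
  mono : ∀ s s', s ≤ s' → time s < time s' ∨
    (time s = time s' ∧ extDist (Function.leftLim g (time s)) (space s) ≤
      extDist (Function.leftLim g (time s)) (space s'))

/-- The `M₁` distance on `[0,T]`. -/
def distM1 (T : ℝ≥0) (g h : ℝ≥0 → ℝ≥0∞) : ℝ≥0∞ :=
  ⨅ (p : GraphParam g T) (q : GraphParam h T),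
    max (⨆ s, edist (p.time s) (q.time s)) (⨆ s, ENNReal.ofReal (extDist (p.space s) (q.space s)))

/-- The `M₁` distance on `[0,∞)`: `∫_0^∞ e^{-t} (1 ∧ d_t(g,h)) dt`, where `d_t` is the `M₁`
distance on `[0,t]`. -/
def distM1Infty (g h : SkorokhodSpace) : ℝ≥0∞ :=
  ∫⁻ t in Ioi (0 : ℝ), ENNReal.ofReal (Real.exp (-t)) * min 1 (distM1 t.toNNReal g.1 h.1)

/-- The `M₁` topology: a set is open if with each of its points it contains a ball of the `M₁`
distance around that point. -/
instance : TopologicalSpace SkorokhodSpace where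
  IsOpen O := ∀ g ∈ O, ∃ ε : ℝ≥0∞, 0 < ε ∧ ∀ h, distM1Infty g h < ε → h ∈ O
  isOpen_univ := fun _ _ => ⟨1, one_pos, fun _ _ => mem_univ _⟩
  isOpen_inter := by
    intro A B hA hB g hg
    obtain ⟨a, ha, hA'⟩ := hA g hg.1
    obtain ⟨b, hb, hB'⟩ := hB g hg.2
    exact ⟨min a b, lt_min ha hb, fun h hh =>
      ⟨hA' h (hh.trans_le (min_le_left _ _)), hB' h (hh.trans_le (min_le_right _ _))⟩⟩
  isOpen_sUnion := by
    rintro S hS g ⟨A, hAS, hgA⟩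
    obtain ⟨a, ha, hA'⟩ := hS A hAS g hgA
    exact ⟨a, ha, fun h hh => ⟨A, hAS, hA' h hh⟩⟩

instance : MeasurableSpace SkorokhodSpace := borel _

instance : BorelSpace SkorokhodSpace := ⟨rfl⟩

/-! ## Path inverses -/

/-- The path inverse `Z^←(y) = inf {t : Z(t) < y}`, with `inf ∅ = ∞`. -/
def pathInv (Z : ℝ≥0 → ℝ≥0∞) (y : ℝ≥0) : ℝ≥0∞ :=
  ⨅ (t : ℝ≥0) (_ : Z t < y), (t : ℝ≥0∞)

theorem pathInv_antitone (Z : ℝ≥0 → ℝ≥0∞) : Antitone (pathInv Z) := fun _ _ hab =>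
  le_iInf₂ fun t ht => iInf₂_le t (ht.trans_le (ENNReal.coe_le_coe.2 hab))

/-- The path inverse as an element of `𝔻([0,∞))`. The function `pathInv Z` is nonincreasing, and
it is left continuous because of the strict inequality in its definition; the element of
`𝔻([0,∞))` that it stands for is its right continuous version `y ↦ Z^←(y+)`. -/
def pathInvPath (Z : ℝ≥0 → ℝ≥0∞) : SkorokhodSpace :=
  ⟨Function.rightLim (pathInv Z), fun t =>
    ⟨continuousWithinAt_rightLim_Ici ((pathInv_antitone Z).tendsto_rightLim t),
      ⟨_, (pathInv_antitone Z).rightLim.tendsto_leftLim t⟩⟩⟩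

/-! ## The empirical processes -/

section Empirical

variable {Ω : Type*}

/-- The partial maximum `M_k = max {X_0, …, X_{k-1}}`. -/
def partialMax (X : ℕ → Ω → EReal) (k : ℕ) (ω : Ω) : EReal :=
  (Finset.range k).sup fun j => X j ω

/-- The empirical two-dimensional rare events point process
`N_n = ∑_{j ≥ 0} δ_{(j/n, u_n⁻¹(X_j))}`. -/
def empiricalREPP (u : ℕ+ → ℝ≥0 → EReal) (X : ℕ → Ω → EReal) (n : ℕ+) (ω : Ω) :
    PointMeasure (ℝ≥0 × ℝ≥0) :=
  timeMarkPointMeasure n fun j => Function.invFun (u n) (X j ω)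

/-- The process `Z_n(t) = u_n⁻¹(M_{⌊nt⌋+1})`. -/
def empiricalZ (u : ℕ+ → ℝ≥0 → EReal) (X : ℕ → Ω → EReal) (n : ℕ+) (ω : Ω) (t : ℝ≥0) : ℝ≥0∞ :=
  (Function.invFun (u n) (partialMax X (⌊((n : ℕ) : ℝ≥0) * t⌋₊ + 1) ω) : ℝ≥0)

end Empirical

/-! ## The limiting process -/

/-- `H̄(τ) = e^{-θτ}`. -/
def survivalH (θ : ℝ) (τ : ℝ≥0) : ℝ := Real.exp (-θ * τ)

/-- `Z` is a version of the process `Z_H`: its paths lie in `𝔻([0,∞))` and, for all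
`0 ≤ t_1 < ⋯ < t_k` and all `y_1, …, y_k ≥ 0`, with `t_0 = 0`,
`P(Z(t_1) ≥ y_1, …, Z(t_k) ≥ y_k) = ∏_i H̄(max_{j ≥ i} y_j)^{t_i - t_{i-1}}`. -/
def IsProcessZH {Ω : Type*} [MeasurableSpace Ω] (θ : ℝ) (Z : Ω → SkorokhodSpace)
    (P : Measure Ω) : Prop :=
  (∀ t, Measurable fun ω => (Z ω).1 t) ∧
  ∀ (k : ℕ) (t y : Fin k → ℝ≥0), StrictMono t →
    P.real {ω | ∀ i, (y i : ℝ≥0∞) ≤ (Z ω).1 (t i)} =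
      ∏ i, survivalH θ ((Finset.Ici i).sup y) ^
        ((t i : ℝ) - ((Fin.cons 0 t : Fin (k + 1) → ℝ≥0) i.castSucc : ℝ))

end

/-! Everything reduces to areas of unions of rectangles `[0,t_i) × [0,y_i)`. The event `Z_n(t_i) ≥
y_i` for all `i` says that `N_n` has no point in the union of the `[0,t_i] × [0,y_i)`, so its
probability is a void probability. Weak convergence of `N_n` makes it converge to the void
probability of the limit: compare with Laplace functionals of tent functions supported on the
rectangles, and use that the area depends continuously on the rectangles to absorb the boundary
(`tendsto_measureReal_of_tent`).

For the Mori–Hsing limit, a cluster `(T, U Y_ℓ)` with `Y_ℓ ≥ 1` and an atom at `1` meets such a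
region exactly when its lowest point `(T, U)` does. The lowest points form a Poisson process of
intensity `θ` on the quadrant, so the void probability is `exp(-θ · area)`
(`IsMoriHsing.measureReal_void`). The product that defines the law of `Z_H` is the same expression,
since on `(t_{i-1}, t_i)` the union has height `max_{j ≥ i} y_j` (`prod_survivalH_eq`).

Path inverses inherit this: `Z^←(q+) > c` if and only if `Z(t) ≥ y` for some `t > c` and `y > q`.
Shifting the rectangles by `ε` and letting `ε → 0` gives convergence of the probabilities of upper
orthants for finitely many values of `Z_n^←` (`tendsto_measureReal_pathInvPath`), hence weak
convergence of the values at all rationals `j/(k+1)`, as a random element of a countable product of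
copies of `[0,∞]`.

For nonincreasing paths, convergence at these points already implies `M₁` convergence
(`tendsto_distM1Infty_of_antitone`). With heights measured in the coordinate `x/(1+x)`, each line `t
- x = w` meets a decreasing completed graph at most once, so `w` parametrizes the graph, and close
graphs are crossed at nearby points. Thus, on nonincreasing paths, `M₁`-open sets are preimages of
open sets under the map to grid values, and weak convergence transfers back through that map.
Finiteness of `Z_H^←(y)` for `y > 0` holds because `P(Z_H(n) ≥ c) = exp(-θ c n)` tends to `0` for
every `c > 0`. -/

noncomputable section

/-! ## Parametrizations of decreasing graphs -/

section CrossTime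

/-- The time at which the graph of a decreasing function `f`, restricted to `[0,T]`, crosses the
line `{(t, x) | t - x = w}`. -/
def crossTime (f : ℝ≥0 → ℝ) (T : ℝ≥0) (w : ℝ) : ℝ≥0 :=
  sSup {t | t ≤ T ∧ (t : ℝ) - f t ≤ w}

variable {f h : ℝ≥0 → ℝ} {T : ℝ≥0} {w w' : ℝ}

theorem crossTime_bddAbove (f : ℝ≥0 → ℝ) (T : ℝ≥0) (w : ℝ) :
    BddAbove {t : ℝ≥0 | t ≤ T ∧ (t : ℝ) - f t ≤ w} := ⟨T, fun _ ht => ht.1⟩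

theorem crossTime_le (f : ℝ≥0 → ℝ) (T : ℝ≥0) (w : ℝ) : crossTime f T w ≤ T :=
  csSup_le' fun _ ht => ht.1

theorem le_crossTime {t : ℝ≥0} (ht : t ≤ T) (h : (t : ℝ) - f t ≤ w) : t ≤ crossTime f T w :=
  le_csSup (crossTime_bddAbove f T w) ⟨ht, h⟩

theorem lt_sub_of_crossTime_lt {t : ℝ≥0} (ht : t ≤ T) (h : crossTime f T w < t) :
    w < (t : ℝ) - f t := by
  by_contra! hc
  exact h.not_ge (le_crossTime ht hc)

theorem exists_of_lt_crossTime {t : ℝ≥0} (h : t < crossTime f T w) :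
    ∃ t', t < t' ∧ t' ≤ T ∧ (t' : ℝ) - f t' ≤ w := by
  obtain ⟨t', ht', h'⟩ := exists_lt_of_lt_csSup' h
  exact ⟨t', h', ht'.1, ht'.2⟩

theorem crossTime_mono (f : ℝ≥0 → ℝ) (T : ℝ≥0) : Monotone (crossTime f T) := fun _ _ hw =>
  csSup_le_csSup' (crossTime_bddAbove _ _ _) fun _ ht => ⟨ht.1, ht.2.trans hw⟩

/-- Moving a time back by `w' - w` can only raise `f`, so `t - f t` drops by at least `w' - w`. With
monotonicity of `crossTime` this makes both coordinates of the crossing point, `crossTime` and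
`crossTime - w`, 1-Lipschitz in `w`. -/
theorem crossTime_le_add (hf : Antitone f) (hw : w ≤ w') :
    (crossTime f T w' : ℝ) ≤ crossTime f T w + (w' - w) := by
  have : crossTime f T w' ≤ crossTime f T w + (w' - w).toNNReal := by
    refine csSup_le' fun t ht => ?_
    rw [← tsub_le_iff_right]
    rcases le_total t (w' - w).toNNReal with h | h
    · simp [tsub_eq_zero_of_le h]
    · refine le_crossTime (tsub_le_self.trans ht.1) ?_
      have h1 := hf (tsub_le_self : t - (w' - w).toNNReal ≤ t)
      rw [NNReal.coe_sub h, Real.coe_toNNReal _ (sub_nonneg.2 hw)]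
      linarith [ht.2]
  have h2 := NNReal.coe_le_coe.2 this
  rwa [NNReal.coe_add, Real.coe_toNNReal _ (sub_nonneg.2 hw)] at h2

theorem abs_crossTime_sub_le (hf : Antitone f) (w w' : ℝ) :
    |(crossTime f T w : ℝ) - crossTime f T w'| ≤ |w - w'| := by
  wlog hw : w ≤ w' generalizing w w'
  · rw [abs_sub_comm, abs_sub_comm w]
    exact this _ _ (le_of_not_ge hw)
  have h1 := crossTime_le_add (T := T) hf hw
  have h2 : (crossTime f T w : ℝ) ≤ crossTime f T w' := crossTime_mono f T hw
  rw [abs_sub_comm, abs_of_nonneg (by linarith), abs_sub_comm, abs_of_nonneg (by linarith)]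
  linarith

theorem abs_crossTime_sub_sub_le (hf : Antitone f) (w w' : ℝ) :
    |((crossTime f T w : ℝ) - w) - (crossTime f T w' - w')| ≤ |w - w'| := by
  wlog hw : w ≤ w' generalizing w w'
  · rw [abs_sub_comm, abs_sub_comm w]
    exact this _ _ (le_of_not_ge hw)
  have h1 := crossTime_le_add (T := T) hf hw
  have h2 : (crossTime f T w : ℝ) ≤ crossTime f T w' := crossTime_mono f T hw
  rw [abs_of_nonneg (by linarith), abs_sub_comm, abs_of_nonneg (by linarith)]
  linarith

theorem continuous_crossTime (hf : Antitone f) : Continuous (crossTime f T) := by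
  refine NNReal.isEmbedding_coe.continuous_iff.2 ?_
  refine LipschitzWith.continuous (K := 1) (LipschitzWith.of_dist_le_mul fun w w' => ?_)
  simpa [Real.dist_eq] using abs_crossTime_sub_le hf w w'

/-- Together with `crossTime_sub_le_apply`, this puts the point at time `crossTime f T w` and height
`crossTime f T w - w` on the completed graph. To the right of the crossing `w < t - f t`, and right
continuity carries this to the crossing itself; if the crossing is at `T`, the bound on `w` takes
over. -/
theorem apply_crossTime_le (hrc : ∀ t, ContinuousWithinAt f (Ici t) t)
    (hw : w ≤ T - f T) : f (crossTime f T w) ≤ crossTime f T w - w := by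
  rcases (crossTime_le f T w).eq_or_lt with h | h
  · rw [h]; linarith
  · set a := crossTime f T w with ha
    have h1 : Tendsto (fun t : ℝ≥0 => (t : ℝ) - f t) (𝓝[>] a) (𝓝 (a - f a)) :=
      ((NNReal.continuous_coe.tendsto a).mono_left nhdsWithin_le_nhds).sub
        ((hrc a).mono_left (nhdsWithin_mono _ Ioi_subset_Ici_self))
    have : (𝓝[>] a).NeBot := nhdsGT_neBot_of_exists_gt ⟨T, h⟩
    have h2 : w ≤ a - f a := by
      refine ge_of_tendsto h1 ?_
      filter_upwards [Ioc_mem_nhdsGT h] with t ht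
      exact (lt_sub_of_crossTime_lt ht.2 ht.1).le
    linarith

theorem crossTime_sub_le_apply (hf : Antitone f) {t : ℝ≥0} (ht : t < crossTime f T w) :
    (crossTime f T w : ℝ) - w ≤ f t := by
  refine le_of_forall_pos_lt_add fun ε hε => ?_
  have : crossTime f T w - ε.toNNReal < crossTime f T w :=
    tsub_lt_self ((zero_le (a := t)).trans_lt ht) (Real.toNNReal_pos.2 hε)
  obtain ⟨t', h1, -, h3⟩ := exists_of_lt_crossTime (max_lt ht this)
  have h4 := hf ((le_max_left _ _).trans h1.le)
  have h5 : (crossTime f T w : ℝ) < t' + ε := by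
    have h6 : crossTime f T w < t' + ε.toNNReal := by
      have := (le_max_right t _).trans_lt h1
      exact lt_add_of_tsub_lt_right this
    have h7 := NNReal.coe_lt_coe.2 h6
    rwa [NNReal.coe_add, Real.coe_toNNReal _ hε.le] at h7
  linarith

theorem crossTime_sub_le_apply_zero (hf : Antitone f) (hw : -f 0 ≤ w) :
    (crossTime f T w : ℝ) - w ≤ f 0 := by
  rcases (zero_le (a := crossTime f T w)).eq_or_lt with h | h
  · rw [← h]; simp; linarith
  · exact crossTime_sub_le_apply hf h

/-- Surjectivity of the parametrization by `w`: every point `(t, x)` of the completed graph is the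
crossing point of its own line `w = t - x`. -/
theorem crossTime_eq (hf : Antitone f) {t : ℝ≥0} {x : ℝ} (ht : t ≤ T) (hx : f t ≤ x)
    (hx' : ∀ t' < t, x ≤ f t') : crossTime f T (t - x) = t := by
  refine le_antisymm (csSup_le' fun t' ht' => ?_) ?_
  · by_contra! hc
    have h1 := hf hc.le
    have h2 := NNReal.coe_lt_coe.2 hc
    linarith [ht'.2]
  · refine le_of_forall_lt fun t' ht' => ?_
    obtain ⟨t'', h1, h2⟩ := exists_between ht'
    refine h1.trans_le (le_crossTime (h2.le.trans ht) ?_)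
    have h3 := NNReal.coe_lt_coe.2 h2
    linarith [hx' _ h2]

/-- If two decreasing functions are close on a fine set of times, their graphs cross lines of slope
one at nearby times. -/
theorem crossTime_sub_le_of_close (hf : Antitone f) (hh : Antitone h) {η : ℝ}
    (hclose : ∀ a b : ℝ≥0, b ≤ T → (a : ℝ) + η < b → ∃ τ, a < τ ∧ τ < b ∧ |f τ - h τ| ≤ η)
    (w : ℝ) : (crossTime h T w : ℝ) - crossTime f T w ≤ η := by
  by_contra! hc
  -- Strictly between the crossings, `f` is already at most `crossTime f T w - w` and `h` is still
  -- at least `crossTime h T w - w`, so at `τ` they differ by more than `η`.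
  obtain ⟨τ, h1, h2, h3⟩ := hclose (crossTime f T w) (crossTime h T w) (crossTime_le _ _ _)
    (by linarith)
  have h4 : (crossTime h T w : ℝ) - w ≤ h τ := crossTime_sub_le_apply hh h2
  have h5 : f τ ≤ crossTime f T w - w := by
    refine le_of_forall_pos_lt_add fun ε hε => ?_
    have : crossTime f T w < crossTime f T w + ε.toNNReal :=
      lt_add_of_pos_right _ (Real.toNNReal_pos.2 hε)
    obtain ⟨t, h6, h7⟩ := exists_between (lt_min this h1)
    have h8 := lt_sub_of_crossTime_lt ((h7.le.trans (min_le_right _ _)).trans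
      (h2.le.trans (crossTime_le _ _ _))) h6
    have h9 := hf (h7.le.trans (min_le_right _ _))
    have h10 := NNReal.coe_lt_coe.2 (h7.trans_le (min_le_left _ _))
    rw [NNReal.coe_add, Real.coe_toNNReal _ hε.le] at h10
    linarith
  have := (abs_le.1 h3).1
  linarith

end CrossTime

/-! ### The coordinate `x/(1+x)` and the `M₁` distance of decreasing functions -/

/-- The order isomorphism `x ↦ x/(1+x)` of `[0,∞]` with `[0,1]`, as a real number. -/
def toUnit (x : ℝ≥0∞) : ℝ := ENNReal.orderIsoUnitIntervalBirational x

theorem toUnit_mem (x : ℝ≥0∞) : toUnit x ∈ Icc (0 : ℝ) 1 :=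
  (ENNReal.orderIsoUnitIntervalBirational x).2

theorem toUnit_strictMono : StrictMono toUnit := fun _ _ h =>
  ENNReal.orderIsoUnitIntervalBirational.strictMono h

theorem continuous_toUnit : Continuous toUnit :=
  continuous_subtype_val.comp ENNReal.orderIsoUnitIntervalBirational.continuous

theorem extDist_eq (x y : ℝ≥0∞) : extDist x y = |toUnit x - toUnit y| := rfl

/-- The inverse of `toUnit`, extended to `ℝ` by projecting on `[0,1]`. -/
def ofUnit (x : ℝ) : ℝ≥0∞ :=
  ENNReal.orderIsoUnitIntervalBirational.symm (projIcc 0 1 zero_le_one x)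

theorem continuous_ofUnit : Continuous ofUnit :=
  ENNReal.orderIsoUnitIntervalBirational.symm.continuous.comp continuous_projIcc

theorem toUnit_ofUnit {x : ℝ} (hx : x ∈ Icc (0 : ℝ) 1) : toUnit (ofUnit x) = x := by
  simp [toUnit, ofUnit, projIcc_of_mem _ hx]

theorem ofUnit_toUnit (x : ℝ≥0∞) : ofUnit (toUnit x) = x := by
  unfold toUnit ofUnit
  rw [projIcc_val, OrderIso.symm_apply_apply]

/-- Replaces the left limit by order conditions. The clause `x ≤ g 0` matters only at `t = 0`, where
the last condition is vacuous and the left limit is `g 0` by convention. -/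
theorem Antitone.mem_completedGraph_iff {g : ℝ≥0 → ℝ≥0∞} (hg : Antitone g) {T t : ℝ≥0}
    {x : ℝ≥0∞} : (t, x) ∈ completedGraph g T ↔
      t ≤ T ∧ g t ≤ x ∧ x ≤ g 0 ∧ ∀ t' < t, x ≤ g t' := by
  have hle : g t ≤ Function.leftLim g t := hg.le_leftLim le_rfl
  simp only [completedGraph, mem_ofPred_eq, uIcc_of_ge hle, mem_Icc]
  refine and_congr_right fun _ => and_congr_right fun _ => ⟨fun h => ?_, fun h => ?_⟩
  · refine ⟨?_, fun t' ht' => h.trans (hg.leftLim_le ht')⟩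
    rcases (zero_le (a := t)).eq_or_lt with h0 | h0
    · rw [← h0] at h
      rwa [leftLim_eq_of_eq_bot] at h
      simp
    · exact h.trans (hg.leftLim_le h0)
  · rcases (zero_le (a := t)).eq_or_lt with h0 | h0
    · rw [← h0, leftLim_eq_of_eq_bot _ (by simp)]
      exact h.1
    · have : (𝓝[<] t).NeBot := nhdsLT_neBot_of_exists_lt ⟨0, h0⟩
      exact _root_.ge_of_tendsto (hg.tendsto_leftLim t)
        (eventually_nhdsWithin_of_forall fun t' ht' => h.2 t' ht')

/-- A continuous nondecreasing map `c` of `[0,1]` onto the range of values of `t - x` on the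
completed graph of a decreasing `g` yields a parametrization. -/
def antitoneGraphParam {g : ℝ≥0 → ℝ≥0∞} (hg : Antitone g)
    (hrc : ∀ t, ContinuousWithinAt g (Ici t) t) (T : ℝ≥0) (c : unitInterval → ℝ)
    (hc : Continuous c) (hmono : Monotone c)
    (hrange : range c = Icc (-toUnit (g 0)) (T - toUnit (g T))) : GraphParam g T :=
  have hf : Antitone fun t => toUnit (g t) := toUnit_strictMono.monotone.comp_antitone hg
  have hfrc : ∀ t, ContinuousWithinAt (fun t => toUnit (g t)) (Ici t) t := fun t =>
    continuous_toUnit.continuousAt.comp_continuousWithinAt (hrc t)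
  have hmem : ∀ s, c s ∈ Icc (-toUnit (g 0)) (T - toUnit (g T)) := fun s =>
    hrange ▸ mem_range_self s
  let l : unitInterval → ℝ≥0 := fun s => crossTime (fun t => toUnit (g t)) T (c s)
  have h1 : ∀ s, toUnit (g (l s)) ≤ l s - c s := fun s => apply_crossTime_le hfrc (hmem s).2
  have h2 : ∀ s, ∀ t < l s, l s - c s ≤ toUnit (g t) := fun s t ht => crossTime_sub_le_apply hf ht
  have h3 : ∀ s, l s - c s ≤ toUnit (g 0) := fun s => crossTime_sub_le_apply_zero hf (hmem s).1
  have h4 : ∀ s, toUnit (ofUnit (l s - c s)) = l s - c s := fun s =>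
    toUnit_ofUnit ⟨(toUnit_mem _).1.trans (h1 s), (h3 s).trans (toUnit_mem _).2⟩
  have h5 : ∀ s, (l s, ofUnit (l s - c s)) ∈ completedGraph g T := fun s => by
    rw [hg.mem_completedGraph_iff]
    simp only [← toUnit_strictMono.le_iff_le, h4]
    exact ⟨crossTime_le _ _ _, h1 s, h3 s, h2 s⟩
  { time := l
    space := fun s => ofUnit (l s - c s)
    continuous_time := (continuous_crossTime hf).comp hc
    continuous_space := continuous_ofUnit.comp
      ((NNReal.continuous_coe.comp ((continuous_crossTime hf).comp hc)).sub hc)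
    range_eq := by
      refine Subset.antisymm ?_ ?_
      · rintro _ ⟨s, rfl⟩
        exact h5 s
      · rintro ⟨t, x⟩ htx
        rw [hg.mem_completedGraph_iff] at htx
        simp only [← toUnit_strictMono.le_iff_le] at htx
        obtain ⟨k1, k2, k3, k4⟩ := htx
        have hw : (t : ℝ) - toUnit x ∈ range c := by
          rw [hrange]
          have k5 : (t : ℝ) ≤ T := k1
          have k6 := hf k1
          have k7 := t.2
          exact ⟨by simp only [NNReal.val_eq_coe] at k7; linarith, by dsimp only at k6; linarith⟩
        obtain ⟨s, hs⟩ := hw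
        have k8 : l s = t := by
          simp only [l, hs]
          exact crossTime_eq hf k1 k2 k4
        refine ⟨s, ?_⟩
        simp only [k8, hs, sub_sub_cancel, ofUnit_toUnit]
    mono := by
      intro s s' hs
      rcases (crossTime_mono (fun t => toUnit (g t)) T (hmono hs)).lt_or_eq with h | h
      · exact Or.inl h
      -- While the time stands still, the height `l s - c s` decreases as `c` grows, and it starts
      -- at or below the left limit; so the distance to the left limit increases.
      · refine Or.inr ⟨h, ?_⟩
        have k1 : l s' = l s := h.symm
        have k2 : ofUnit (l s - c s) ≤ Function.leftLim g (l s) := by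
          have := (h5 s).2
          rw [uIcc_of_ge (hg.le_leftLim le_rfl)] at this
          exact this.2
        have k3 := toUnit_strictMono.monotone k2
        have k4 := h4 s
        have k5 := h4 s'
        have k6 := hmono hs
        simp only [k1] at k5 ⊢
        simp only [extDist_eq]
        rw [abs_of_nonneg (by linarith), abs_of_nonneg (by linarith)]
        linarith }

theorem antitoneGraphParam_time {g : ℝ≥0 → ℝ≥0∞} (hg : Antitone g)
    (hrc : ∀ t, ContinuousWithinAt g (Ici t) t) (T : ℝ≥0) (c : unitInterval → ℝ)
    (hc : Continuous c) (hmono : Monotone c)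
    (hrange : range c = Icc (-toUnit (g 0)) (T - toUnit (g T))) (s : unitInterval) :
    (antitoneGraphParam hg hrc T c hc hmono hrange).time s =
      crossTime (fun t => toUnit (g t)) T (c s) := rfl

theorem toUnit_antitoneGraphParam_space {g : ℝ≥0 → ℝ≥0∞} (hg : Antitone g)
    (hrc : ∀ t, ContinuousWithinAt g (Ici t) t) (T : ℝ≥0) (c : unitInterval → ℝ)
    (hc : Continuous c) (hmono : Monotone c)
    (hrange : range c = Icc (-toUnit (g 0)) (T - toUnit (g T))) (s : unitInterval) :
    toUnit ((antitoneGraphParam hg hrc T c hc hmono hrange).space s) =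
      crossTime (fun t => toUnit (g t)) T (c s) - c s := by
  have hmem : c s ∈ Icc (-toUnit (g 0)) (T - toUnit (g T)) := hrange ▸ mem_range_self s
  refine toUnit_ofUnit ⟨?_, ?_⟩
  · exact (toUnit_mem _).1.trans (apply_crossTime_le (fun t =>
      continuous_toUnit.continuousAt.comp_continuousWithinAt (hrc t)) hmem.2)
  · exact (crossTime_sub_le_apply_zero (toUnit_strictMono.monotone.comp_antitone hg) hmem.1).trans
      (toUnit_mem _).2

/-- Clamping an affine map of `[0,1]` onto `[A,B]` gives a monotone map onto a subinterval. -/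
theorem clamp_affine {A B a b : ℝ} (hA : A ≤ a) (hab : a ≤ b) (hB : b ≤ B) :
    Continuous (fun s : unitInterval => max a (min b (A + s * (B - A)))) ∧
    Monotone (fun s : unitInterval => max a (min b (A + s * (B - A)))) ∧
    range (fun s : unitInterval => max a (min b (A + s * (B - A)))) = Icc a b := by
  have hAB : 0 ≤ B - A := by linarith
  refine ⟨by fun_prop, fun s s' hs => ?_, Subset.antisymm ?_ fun x hx => ?_⟩
  · have : (s : ℝ) ≤ s' := hs
    dsimp only
    gcongr
  · rintro _ ⟨s, rfl⟩
    exact ⟨le_max_left _ _, max_le hab (min_le_left _ _)⟩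
  · rcases hAB.eq_or_lt with h0 | h0
    · refine ⟨0, ?_⟩
      have : x = A := by linarith [hx.1, hx.2]
      have h2 : x = a := by linarith [hx.1, hx.2]
      have h3 : x = b := by linarith [hx.1, hx.2]
      simp [← h2, ← h3, ← this]
    · refine ⟨⟨(x - A) / (B - A), div_nonneg (by linarith [hx.1]) hAB,
        (div_le_one h0).2 (by linarith [hx.2])⟩, ?_⟩
      simp only [div_mul_cancel₀ _ h0.ne']
      rw [add_sub_cancel, min_eq_right hx.2, max_eq_right hx.1]

theorem abs_clamp_sub_clamp_le (a b a' b' w : ℝ) :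
    |max a (min b w) - max a' (min b' w)| ≤ max |a - a'| |b - b'| := by
  refine (abs_max_sub_max_le_max _ _ _ _).trans (max_le_max le_rfl ?_)
  refine (abs_min_sub_min_le_max _ _ _ _).trans ?_
  simp

/-- The `M₁` distance of two decreasing functions that are close on a fine set of times. -/
theorem distM1_le_of_close {g h : ℝ≥0 → ℝ≥0∞} (hg : Antitone g) (hh : Antitone h)
    (hgr : ∀ t, ContinuousWithinAt g (Ici t) t) (hhr : ∀ t, ContinuousWithinAt h (Ici t) t)
    (T : ℝ≥0) {η : ℝ}
    (hclose : ∀ a b : ℝ≥0, b ≤ T → (a : ℝ) + η < b →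
      ∃ τ, a < τ ∧ τ < b ∧ |toUnit (g τ) - toUnit (h τ)| ≤ η) :
    distM1 T g h ≤ ENNReal.ofReal
      (max |toUnit (g 0) - toUnit (h 0)| |toUnit (g T) - toUnit (h T)| + η) := by
  set f := fun t => toUnit (g t) with hfdef
  set k := fun t => toUnit (h t) with hkdef
  have hf : Antitone f := toUnit_strictMono.monotone.comp_antitone hg
  have hk : Antitone k := toUnit_strictMono.monotone.comp_antitone hh
  -- Both graphs are driven by one affine map onto `[A, B]`, clamped to each graph's own range of `t
  -- - x`. The two clamped parameters then differ by no more than the values of the functions at `0`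
  -- and `T` do.
  set A := min (-f 0) (-k 0)
  set B := max (T - f T) (T - k T)
  have hT : (0 : ℝ) ≤ T := T.2
  obtain ⟨c1, m1, r1⟩ := clamp_affine (A := A) (B := B) (a := -f 0) (b := T - f T)
    (min_le_left _ _) (by linarith [hf (zero_le (a := T))]) (le_max_left _ _)
  obtain ⟨c2, m2, r2⟩ := clamp_affine (A := A) (B := B) (a := -k 0) (b := T - k T)
    (min_le_right _ _) (by linarith [hk (zero_le (a := T))]) (le_max_right _ _)
  set p := antitoneGraphParam hg hgr T _ c1 m1 r1 with hp
  set q := antitoneGraphParam hh hhr T _ c2 m2 r2 with hq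
  have hcross : ∀ w, |(crossTime f T w : ℝ) - crossTime k T w| ≤ η := fun w => by
    rw [abs_le]
    have e1 := crossTime_sub_le_of_close hf hk hclose w
    have e2 := crossTime_sub_le_of_close hk hf
      (fun a b hb hab => by simpa only [abs_sub_comm] using hclose a b hb hab) w
    constructor <;> linarith
  have hclamp : ∀ w, |max (-f 0) (min (T - f T) w) - max (-k 0) (min (T - k T) w)| ≤
      max |f 0 - k 0| |f T - k T| := fun w => by
    refine (abs_clamp_sub_clamp_le _ _ _ _ _).trans (le_of_eq ?_)
    congr 1
    · rw [← abs_neg]; ring_nf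
    · rw [← abs_neg]; ring_nf
  refine (iInf₂_le p q).trans (max_le (iSup_le fun s => ?_) (iSup_le fun s => ?_))
  · rw [edist_dist, NNReal.dist_eq]
    refine ENNReal.ofReal_le_ofReal ?_
    rw [hp, hq, antitoneGraphParam_time, antitoneGraphParam_time]
    refine (abs_sub_le _ (crossTime f T (max (-k 0) (min (T - k T) (A + s * (B - A)))) : ℝ)
      _).trans (add_le_add ?_ (hcross _))
    exact (abs_crossTime_sub_le hf _ _).trans (hclamp _)
  · refine ENNReal.ofReal_le_ofReal ?_
    rw [extDist_eq, hp, hq, toUnit_antitoneGraphParam_space, toUnit_antitoneGraphParam_space]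
    refine (abs_sub_le _ ((crossTime f T (max (-k 0) (min (T - k T) (A + s * (B - A)))) : ℝ) -
      max (-k 0) (min (T - k T) (A + s * (B - A)))) _).trans (add_le_add ?_ ?_)
    · exact (abs_crossTime_sub_sub_le hf _ _).trans (hclamp _)
    · rw [sub_sub_sub_cancel_right]
      exact hcross _

/-! ## Convergence in the `M₁` topology from convergence on grids -/

/-- Every interval longer than the mesh `δ = 1/(k+1)` contains a grid point. The end `T` need not be
one: there both functions are squeezed between their values at the neighbouring grid points, which
costs the oscillation of `g` on `[T-δ, T+δ]`. The index `k(k+1)+1` is that of the grid point just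
after time `k`. -/
theorem distM1_le_of_close_on_grid {g h : ℝ≥0 → ℝ≥0∞} (hg : Antitone g) (hh : Antitone h)
    (hgr : ∀ t, ContinuousWithinAt g (Ici t) t) (hhr : ∀ t, ContinuousWithinAt h (Ici t) t)
    {k : ℕ} {δ : ℝ≥0} (hδ : δ * (k + 1) = 1)
    (hclose : ∀ j ≤ k * (k + 1) + 1, |toUnit (g (j * δ)) - toUnit (h (j * δ))| ≤ δ)
    {T : ℝ≥0} (hT : T ≤ k) :
    distM1 T g h ≤ ENNReal.ofReal (toUnit (g (T - δ)) - toUnit (g (T + δ)) + 2 * δ) := by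
  have hδ0 : 0 < δ := by
    rcases (zero_le (a := δ)).eq_or_lt with h0 | h0
    · rw [← h0] at hδ; simp at hδ
    · exact h0
  have hf : Antitone fun t => toUnit (g t) := toUnit_strictMono.monotone.comp_antitone hg
  have hk : Antitone fun t => toUnit (h t) := toUnit_strictMono.monotone.comp_antitone hh
  have hfloor : ∀ a : ℝ≥0, (⌊a * (k + 1)⌋₊ : ℝ≥0) * δ ≤ a ∧ a < (⌊a * (k + 1)⌋₊ + 1 : ℕ) * δ := by
    intro a
    have h1 : a = a * (k + 1) * δ := by rw [mul_assoc, mul_comm _ δ, hδ, mul_one]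
    constructor
    · conv_rhs => rw [h1]
      gcongr
      exact Nat.floor_le zero_le
    · conv_lhs => rw [h1]
      gcongr
      exact_mod_cast Nat.lt_floor_add_one _
  have hgrid : ∀ j : ℕ, (j : ℝ≥0) * δ ≤ k → j ≤ k * (k + 1) := by
    intro j hj
    have h1 : (j : ℝ≥0) * δ * (k + 1) ≤ k * (k + 1) := by gcongr
    rw [mul_assoc, hδ, mul_one] at h1
    exact_mod_cast h1
  have h0 : |toUnit (g 0) - toUnit (h 0)| ≤ δ := by simpa using hclose 0 (Nat.zero_le _)
  have hend : |toUnit (g T) - toUnit (h T)| ≤ toUnit (g (T - δ)) - toUnit (g (T + δ)) + δ := by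
    obtain ⟨h1, h2⟩ := hfloor T
    set j := ⌊T * (k + 1)⌋₊
    have hj := hgrid j (h1.trans hT)
    have h3 := abs_le.1 (hclose j (hj.trans (Nat.le_succ _)))
    have h4 := abs_le.1 (hclose (j + 1) (Nat.succ_le_succ hj))
    have h5 := hf h1
    have h6 := hf h2.le
    have h7 := hk h1
    have h8 := hk h2.le
    have e : ((j + 1 : ℕ) : ℝ≥0) * δ = j * δ + δ := by push_cast; ring
    have h9 := hf (show T - δ ≤ j * δ from tsub_le_iff_right.2 (e ▸ h2.le))
    have h10 := hf (show ((j + 1 : ℕ) : ℝ≥0) * δ ≤ T + δ by rw [e]; gcongr)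
    rw [abs_le]
    dsimp only at h5 h6 h7 h8 h9 h10
    constructor <;> linarith
  refine (distM1_le_of_close hg hh hgr hhr T (η := δ) fun a b hb hab => ?_).trans
    (ENNReal.ofReal_le_ofReal ?_)
  · obtain ⟨h1, h2⟩ := hfloor a
    have h3 : ((⌊a * (k + 1)⌋₊ + 1 : ℕ) : ℝ≥0) * δ < b := by
      have : a + δ < b := by exact_mod_cast hab
      refine lt_of_le_of_lt ?_ this
      rw [Nat.cast_succ, add_mul, one_mul]
      gcongr
    exact ⟨_, h2, h3, hclose _ ((hgrid _ (h3.le.trans (hb.trans hT))).trans (Nat.le_succ _))⟩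
  · have h1 : 0 ≤ toUnit (g (T - δ)) - toUnit (g (T + δ)) := by
      have := hf (tsub_le_self.trans le_self_add : T - δ ≤ T + δ)
      dsimp only at this
      linarith
    have := max_le (h0.trans (le_add_of_nonneg_left h1)) hend
    linarith

theorem ENNReal.lintegral_exp_neg_Ioi :
    ∫⁻ t in Ioi (0 : ℝ), ENNReal.ofReal (Real.exp (-t)) = 1 := by
  rw [← ofReal_integral_eq_lintegral_ofReal]
  · rw [integral_exp_neg_Ioi, neg_zero, Real.exp_zero, ENNReal.ofReal_one]
  · simpa [IntegrableOn] using exp_neg_integrableOn_Ioi 0 one_pos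
  · exact ae_of_all _ fun t => (Real.exp_pos _).le

/-- The weighted oscillation of a bounded decreasing function at scale `1/(k+1)` tends to `0`. -/
theorem tendsto_lintegral_oscillation {F : ℝ → ℝ} (hF : Antitone F) :
    Tendsto (fun k : ℕ => ∫⁻ t in Ioi (0 : ℝ), ENNReal.ofReal (Real.exp (-t)) *
      (if t ≤ k then min 1 (ENNReal.ofReal (F (t - 1 / (k + 1 : ℝ)) - F (t + 1 / (k + 1 : ℝ)) +
        2 * (1 / (k + 1 : ℝ)))) else 1)) atTop (𝓝 0) := by
  have hFm : Measurable F := hF.measurable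
  have hδ : Tendsto (fun k : ℕ => 1 / (k + 1 : ℝ)) atTop (𝓝 0) :=
    tendsto_one_div_add_atTop_nhds_zero_nat
  rw [← lintegral_zero (μ := volume.restrict (Ioi (0 : ℝ)))]
  refine tendsto_lintegral_of_dominated_convergence (fun t => ENNReal.ofReal (Real.exp (-t)))
    (fun k => ?_) (fun k => ?_) (by simp [ENNReal.lintegral_exp_neg_Ioi]) ?_
  · refine Measurable.mul (by fun_prop) (Measurable.ite measurableSet_Iic (by fun_prop)
      measurable_const)
  · refine ae_of_all _ fun t => ?_
    refine mul_le_of_le_one_right zero_le ?_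
    split_ifs
    exacts [min_le_left _ _, le_rfl]
  · have hc : ∀ᵐ t ∂volume.restrict (Ioi (0 : ℝ)), ContinuousAt F t :=
      ae_restrict_of_ae (hF.countable_not_continuousAt.ae_notMem volume |>.mono fun t ht => by
        simpa using ht)
    filter_upwards [hc] with t ht
    have h1 : Tendsto (fun k : ℕ => F (t - 1 / (k + 1 : ℝ)) - F (t + 1 / (k + 1 : ℝ)) +
        2 * (1 / (k + 1 : ℝ))) atTop (𝓝 0) := by
      have a1 : Tendsto (fun k : ℕ => t - 1 / (k + 1 : ℝ)) atTop (𝓝 t) := by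
        simpa using hδ.const_sub t
      have a2 : Tendsto (fun k : ℕ => t + 1 / (k + 1 : ℝ)) atTop (𝓝 t) := by
        simpa using hδ.const_add t
      simpa using ((ht.tendsto.comp a1).sub (ht.tendsto.comp a2)).add (hδ.const_mul 2)
    have h2 := ENNReal.tendsto_ofReal h1
    rw [ENNReal.ofReal_zero] at h2
    have h3 : Tendsto (fun k : ℕ => ENNReal.ofReal (Real.exp (-t)) * ENNReal.ofReal
        (F (t - 1 / (k + 1 : ℝ)) - F (t + 1 / (k + 1 : ℝ)) + 2 * (1 / (k + 1 : ℝ)))) atTop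
        (𝓝 0) := by
      simpa using ENNReal.Tendsto.const_mul h2 (Or.inr ENNReal.ofReal_ne_top)
    refine tendsto_of_tendsto_of_tendsto_of_le_of_le' tendsto_const_nhds h3
      (Eventually.of_forall fun _ => zero_le) ?_
    filter_upwards [eventually_ge_atTop ⌈t⌉₊] with k hk
    rw [if_pos (Nat.ceil_le.1 hk)]
    gcongr
    exact min_le_right _ _

/-- Decreasing paths that converge at the points `j/(k+1)` converge in the `M₁` topology. -/
theorem tendsto_distM1Infty_of_antitone {g : SkorokhodSpace} (hg : Antitone g.1)
    {h : ℕ → SkorokhodSpace} (hh : ∀ n, Antitone (h n).1)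
    (hconv : ∀ j k : ℕ, Tendsto (fun n => (h n).1 (j * (1 / (k + 1)))) atTop
      (𝓝 (g.1 (j * (1 / (k + 1)))))) :
    Tendsto (fun n => distM1Infty g (h n)) atTop (𝓝 0) := by
  have hf : Antitone fun t => toUnit (g.1 t) := toUnit_strictMono.monotone.comp_antitone hg
  have hF : Antitone fun t : ℝ => toUnit (g.1 t.toNNReal) :=
    hf.comp_monotone fun _ _ h => Real.toNNReal_mono h
  have hosc := tendsto_lintegral_oscillation hF
  rw [ENNReal.tendsto_nhds_zero]
  intro ε hε
  -- The mesh is fixed first, through the oscillation of `g` alone; after that only finitely many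
  -- grid values of `h n` have to be close.
  obtain ⟨k, hk⟩ := ((ENNReal.tendsto_nhds_zero.1 hosc) ε hε).exists
  have hδ0 : (0 : ℝ) < 1 / (k + 1) := by positivity
  have hev : ∀ᶠ n in atTop, ∀ j ∈ Finset.range (k * (k + 1) + 2),
      |toUnit (g.1 (j * (1 / (k + 1)))) - toUnit ((h n).1 (j * (1 / (k + 1))))| ≤
        1 / (k + 1 : ℝ) := by
    rw [Filter.eventually_all_finset]
    intro j _
    have h1 := (continuous_toUnit.tendsto _).comp (hconv j k)
    filter_upwards [(Metric.tendsto_nhds.1 h1) _ hδ0] with n hn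
    rw [abs_sub_comm]
    exact hn.le
  filter_upwards [hev] with n hn
  refine le_trans ?_ hk
  refine setLIntegral_mono' measurableSet_Ioi fun t ht => ?_
  gcongr
  split_ifs with htk
  · refine min_le_min le_rfl ?_
    have hT : t.toNNReal ≤ (k : ℝ≥0) := Real.toNNReal_le_iff_le_coe.2 (by simpa using htk)
    have h1 := distM1_le_of_close_on_grid hg (hh n) (fun t => (g.2 t).1) (fun t => ((h n).2 t).1)
      (k := k) (δ := 1 / (k + 1)) (by field_simp) (fun j hj => by
        have := hn j (Finset.mem_range.2 (Nat.lt_succ_of_le hj))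
        simpa using this) hT
    refine h1.trans (ENNReal.ofReal_le_ofReal (le_of_eq ?_))
    have e1 : (1 / (k + 1) : ℝ≥0) = (1 / (k + 1 : ℝ)).toNNReal := by
      rw [← NNReal.coe_inj, Real.coe_toNNReal _ hδ0.le]; push_cast; rfl
    have ht0 : 0 ≤ t := le_of_lt ht
    rw [e1, ← Real.toNNReal_add ht0 hδ0.le, NNReal.sub_def, Real.coe_toNNReal _ ht0,
      Real.coe_toNNReal _ hδ0.le]
  · exact min_le_left _ _

/-! ## Criteria for weak convergence -/

/-- Weak convergence follows from convergence on a class of sets that is stable under intersections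
and whose finite differences form a basis of neighbourhoods. -/
theorem ProbabilityMeasure.tendsto_of_tendsto_of_diff_biUnion {Y κ : Type*} [MeasurableSpace Y]
    [TopologicalSpace Y] [SecondCountableTopology Y] [OpensMeasurableSpace Y] {S : Set (Set Y)}
    (hinter : ∀ A ∈ S, ∀ B ∈ S, A ∩ B ∈ S) (hmeas : ∀ A ∈ S, MeasurableSet A)
    (hbasis : ∀ u : Set Y, IsOpen u → ∀ x ∈ u, ∃ A ∈ S, ∃ T : Finset (Set Y), (∀ t ∈ T, t ∈ S) ∧
      A \ ⋃ t ∈ T, t ∈ 𝓝 x ∧ A \ ⋃ t ∈ T, t ⊆ u)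
    {l : Filter κ} [l.IsCountablyGenerated] {μ : κ → ProbabilityMeasure Y}
    {ν : ProbabilityMeasure Y}
    (h : ∀ A ∈ S, Tendsto (fun i => (μ i : Measure Y).real A) l (𝓝 ((ν : Measure Y).real A))) :
    Tendsto μ l (𝓝 ν) := by
  classical
  have hpi : IsPiSystem S := fun A hA B hB _ => hinter A hA B hB
  let R : Set (Set Y) := {D | ∃ A ∈ S, ∃ T : Finset (Set Y), (∀ t ∈ T, t ∈ S) ∧
    D = A \ ⋃ t ∈ T, t}
  have hU : ∀ T : Finset (Set Y), (∀ t ∈ T, t ∈ S) → MeasurableSet (⋃ t ∈ T, t) := fun T hT =>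
    T.measurableSet_biUnion fun t ht => hmeas t (hT t ht)
  refine IsPiSystem.tendsto_probabilityMeasure_of_tendsto_of_mem (S := R) ?_ ?_ ?_ ?_
  · rintro _ ⟨A, hA, T, hT, rfl⟩ _ ⟨B, hB, T', hT', rfl⟩ _
    refine ⟨A ∩ B, hinter A hA B hB, T ∪ T', ?_, ?_⟩
    · simp only [Finset.mem_union]
      rintro t (ht | ht)
      exacts [hT t ht, hT' t ht]
    · rw [Finset.set_biUnion_union]
      ext x
      simp only [mem_inter_iff, Set.mem_sdiff, mem_union]
      tauto
  · rintro _ ⟨A, hA, T, hT, rfl⟩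
    exact (hmeas A hA).diff (hU T hT)
  · intro u hu x hx
    obtain ⟨A, hA, T, hT, h1, h2⟩ := hbasis u hu x hx
    exact ⟨_, ⟨A, hA, T, hT, rfl⟩, h1, h2⟩
  · rintro _ ⟨A, hA, T, hT, rfl⟩
    -- The removed part is the union of the sets `A ∩ t`, which lie in the intersection-stable
    -- class, so inclusion-exclusion gives convergence of its measure.
    have key : ∀ m : ProbabilityMeasure Y, ((m (A \ ⋃ t ∈ T, t) : ℝ≥0) : ℝ) =
        (m : Measure Y).real A - (m : Measure Y).real (⋃ t ∈ T.image (A ∩ ·), t) := by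
      intro m
      have e : (⋃ t ∈ T.image (A ∩ ·), t) = A ∩ ⋃ t ∈ T, t := by
        rw [Finset.set_biUnion_finset_image, inter_iUnion₂]
      have := measureReal_inter_add_sdiff (μ := (m : Measure Y)) (s := A) (hU T hT)
      rw [e, ← this, add_sub_cancel_left]
      rfl
    rw [← NNReal.tendsto_coe]
    simp only [key]
    refine (h A hA).sub (hpi.tendsto_measureReal_biUnion ?_ hmeas h)
    simp only [Finset.mem_image]
    rintro _ ⟨t, ht, rfl⟩
    exact hinter A hA t (hT t ht)

/-- An upper set of `[0,∞]` is admissible if it is empty or contains a finite element. -/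
def IsFiniteUpperSet (U : Set ℝ≥0∞) : Prop :=
  IsUpperSet U ∧ (U = ∅ ∨ ∃ c : ℝ≥0, (c : ℝ≥0∞) ∈ U)

theorem IsFiniteUpperSet.inter {U V : Set ℝ≥0∞} (hU : IsFiniteUpperSet U)
    (hV : IsFiniteUpperSet V) : IsFiniteUpperSet (U ∩ V) := by
  refine ⟨hU.1.inter hV.1, ?_⟩
  rcases hU.2 with rfl | ⟨c, hc⟩
  · simp
  rcases hV.2 with rfl | ⟨d, hd⟩
  · simp
  · exact Or.inr ⟨max c d, hU.1 (by simp) hc, hV.1 (by simp) hd⟩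

theorem isFiniteUpperSet_univ : IsFiniteUpperSet univ := ⟨isUpperSet_univ, Or.inr ⟨0, mem_univ _⟩⟩

theorem isFiniteUpperSet_Ioi (b : ℝ≥0∞) : IsFiniteUpperSet (Ioi b) := by
  refine ⟨isUpperSet_Ioi b, ?_⟩
  induction b with
  | top => left; simp
  | coe b => exact Or.inr ⟨b + 1, ENNReal.coe_lt_coe.2 (lt_add_one b)⟩

theorem isFiniteUpperSet_Ici {a : ℝ≥0∞} (ha : a ≠ ∞) : IsFiniteUpperSet (Ici a) :=
  ⟨isUpperSet_Ici a, Or.inr ⟨a.toNNReal, by simp [ha]⟩⟩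

theorem IsUpperSet.measurableSet_ennreal {U : Set ℝ≥0∞} (hU : IsUpperSet U) : MeasurableSet U :=
  hU.ordConnected.measurableSet

/-- Convergence in distribution of random sequences in `[0,∞]` from the convergence of the
probabilities of finite-dimensional upper orthants. -/
theorem tendstoInDistribution_pi_of_tendsto_upperSets {ι κ Ω Ω' : Type*} [Countable ι]
    [MeasurableSpace Ω] [MeasurableSpace Ω'] {P : Measure Ω} [IsProbabilityMeasure P]
    {P' : Measure Ω'} [IsProbabilityMeasure P'] {l : Filter κ} [l.IsCountablyGenerated]
    {X : κ → Ω → ι → ℝ≥0∞} {X' : Ω' → ι → ℝ≥0∞} (hX : ∀ n, AEMeasurable (X n) P)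
    (hX' : AEMeasurable X' P')
    (h : ∀ (F : Finset ι) (U : ι → Set ℝ≥0∞), (∀ i, IsFiniteUpperSet (U i)) →
      Tendsto (fun n => P.real {ω | ∀ i ∈ F, X n ω i ∈ U i}) l
        (𝓝 (P'.real {ω | ∀ i ∈ F, X' ω i ∈ U i}))) :
    TendstoInDistribution X l X' (fun _ => P) P' := by
  classical
  refine ⟨hX, hX', ?_⟩
  let S : Set (Set (ι → ℝ≥0∞)) := {A | ∃ (F : Finset ι) (U : ι → Set ℝ≥0∞),
    (∀ i, IsFiniteUpperSet (U i)) ∧ A = {a | ∀ i ∈ F, a i ∈ U i}}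
  have hmeas : ∀ A ∈ S, MeasurableSet A := by
    rintro _ ⟨F, U, hU, rfl⟩
    have : {a : ι → ℝ≥0∞ | ∀ i ∈ F, a i ∈ U i} = (F : Set ι).pi U := by ext; simp
    rw [this]
    exact MeasurableSet.pi F.countable_toSet fun i _ => (hU i).1.measurableSet_ennreal
  refine ProbabilityMeasure.tendsto_of_tendsto_of_diff_biUnion (S := S) ?_ hmeas ?_ ?_
  · rintro _ ⟨F, U, hU, rfl⟩ _ ⟨F', U', hU', rfl⟩
    refine ⟨F ∪ F', fun i => (if i ∈ F then U i else univ) ∩ (if i ∈ F' then U' i else univ),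
      fun i => ?_, ?_⟩
    · refine IsFiniteUpperSet.inter ?_ ?_
      · split_ifs
        exacts [hU i, isFiniteUpperSet_univ]
      · split_ifs
        exacts [hU' i, isFiniteUpperSet_univ]
    · ext a
      simp only [mem_inter_iff, mem_ofPred_eq, Finset.mem_union]
      grind
  · intro u hu x hx
    have h1 := hu.mem_nhds hx
    rw [nhds_pi, Filter.mem_pi] at h1
    obtain ⟨I, hI, t, ht, htu⟩ := h1
    have h2 : ∀ i, ∃ a b : ℝ≥0∞, a ≠ ∞ ∧ Icc a b ∈ 𝓝 (x i) ∧ Icc a b ⊆ t i := by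
      intro i
      obtain ⟨a, b, hab, h3, h4⟩ := exists_Icc_mem_subset_of_mem_nhds (ht i)
      refine ⟨a, b, ?_, h3, h4⟩
      -- A lower end `∞` would make `{∞}` a neighbourhood of `∞`, but `∞` is not isolated. So the
      -- lower end is finite, as `IsFiniteUpperSet` requires.
      rintro rfl
      have h5 : Icc (∞ : ℝ≥0∞) b ⊆ {∞} := fun z hz => top_le_iff.1 hz.1
      have h6 : x i = ∞ := h5 (mem_of_mem_nhds h3)
      rw [h6] at h3
      have h7 := mem_of_superset h3 h5
      obtain ⟨c, hc', hc⟩ := (ENNReal.nhds_top_basis.mem_iff.1 h7)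
      obtain ⟨d, hd1, hd2⟩ := exists_between hc'
      exact hd2.ne (hc hd1)
    choose a b ha hab hsub using h2
    -- A closed box is the upper orthant at its lower corner minus the sets where some coordinate
    -- exceeds its upper end.
    refine ⟨{z | ∀ i ∈ hI.toFinset, z i ∈ Ici (a i)}, ⟨hI.toFinset, _,
      fun i => isFiniteUpperSet_Ici (ha i), rfl⟩, hI.toFinset.image fun i =>
        {z | ∀ j ∈ ({i} : Finset ι), z j ∈ Ioi (b j)}, ?_, ?_⟩
    · simp only [Finset.mem_image]
      rintro _ ⟨i, -, rfl⟩
      exact ⟨{i}, _, fun j => isFiniteUpperSet_Ioi (b j), rfl⟩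
    · have e : ({z | ∀ i ∈ hI.toFinset, z i ∈ Ici (a i)} \ ⋃ t ∈ hI.toFinset.image fun i =>
          {z : ι → ℝ≥0∞ | ∀ j ∈ ({i} : Finset ι), z j ∈ Ioi (b j)}, t) =
          I.pi fun i => Icc (a i) (b i) := by
        ext z
        simp only [Finset.set_biUnion_finset_image, Set.mem_sdiff, mem_ofPred_eq, mem_iUnion,
          Finset.mem_singleton, forall_eq, Set.Finite.mem_toFinset, mem_Ici, mem_Ioi,
          not_exists, not_lt, Set.mem_pi, mem_Icc, exists_prop, not_and, ← forall_and]
      rw [e]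
      exact ⟨set_pi_mem_nhds hI fun i _ => hab i, (pi_mono fun i _ => hsub i).trans htu⟩
  · rintro _ ⟨F, U, hU, rfl⟩
    have hA := hmeas _ ⟨F, U, hU, rfl⟩
    simp only [ProbabilityMeasure.coe_mk, map_measureReal_apply_of_aemeasurable (hX _) hA,
      map_measureReal_apply_of_aemeasurable hX' hA]
    exact h F U hU

/-- If `J` separates neighbourhoods on `E`, open sets of `E` are preimages under `J`. -/
theorem exists_isOpen_preimage_of_nhds {S Y : Type*} [TopologicalSpace S] [TopologicalSpace Y]
    {J : S → Y} {E : Set S}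
    (hJ : ∀ s ∈ E, ∀ O, IsOpen O → s ∈ O → ∃ V ∈ 𝓝 (J s), ∀ r ∈ E, J r ∈ V → r ∈ O)
    {O : Set S} (hO : IsOpen O) : ∃ V, IsOpen V ∧ ∀ s ∈ E, s ∈ O ↔ J s ∈ V := by
  refine ⟨⋃₀ {V | IsOpen V ∧ ∀ r ∈ E, J r ∈ V → r ∈ O}, isOpen_sUnion fun V hV => hV.1,
    fun s hs => ⟨fun hsO => ?_, ?_⟩⟩
  · obtain ⟨V, hV, h⟩ := hJ s hs O hO hsO
    obtain ⟨W, hWV, hW, hsW⟩ := mem_nhds_iff.1 hV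
    exact ⟨W, ⟨hW, fun r hr hrW => h r hr (hWV hrW)⟩, hsW⟩
  · rintro ⟨V, hV, hsV⟩
    exact hV.2 s hs hsV

/-! ### Transfer of weak convergence along a map -/

section Transfer

variable {S Y κ Ω Ω' : Type*} [TopologicalSpace S] [MeasurableSpace S] [BorelSpace S]
  [TopologicalSpace Y] [MeasurableSpace Y] [BorelSpace Y] [MeasurableSpace Ω] [MeasurableSpace Ω']
  {P : Measure Ω} {P' : Measure Ω'} {J : S → Y} {E : Set S}

/-- The measurable version of `J ∘ X` need not take values in `J '' E`. So `X` itself is kept, and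
made constant on a measurable null set outside which `J ∘ X` agrees with that version. -/
theorem aemeasurable_of_comp
    (hJ : ∀ O, IsOpen O → ∃ V, IsOpen V ∧ ∀ s ∈ E, s ∈ O ↔ J s ∈ V)
    {X : Ω → S} (hXE : ∀ ω, X ω ∈ E) (hX : AEMeasurable (fun ω => J (X ω)) P) :
    AEMeasurable X P := by
  classical
  rcases isEmpty_or_nonempty Ω with h | ⟨⟨ω₀⟩⟩
  · exact (measurable_of_empty X).aemeasurable
  obtain ⟨N, hN, hNm, hNP⟩ := exists_measurable_superset_of_null (ae_iff.1 hX.ae_eq_mk)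
  refine ⟨N.piecewise (fun _ => X ω₀) X, measurable_of_isOpen fun O hO => ?_, ?_⟩
  · obtain ⟨V, hV, hOV⟩ := hJ O hO
    have e : N.piecewise (fun _ => X ω₀) X ⁻¹' O =
        N.ite ((fun _ : Ω => X ω₀) ⁻¹' O) (hX.mk _ ⁻¹' V) := by
      rw [piecewise_preimage]
      ext ω
      by_cases hω : ω ∈ N
      · simp [Set.ite, hω]
      · have h1 : J (X ω) = hX.mk _ ω := by
          by_contra h2
          exact hω (hN h2)
        simp [Set.ite, hω, hOV _ (hXE ω), h1]
    rw [e]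
    exact hNm.ite (MeasurableSet.const (X ω₀ ∈ O)) (hX.measurable_mk hV.measurableSet)
  · refine (measure_eq_zero_iff_ae_notMem.1 hNP).mono fun ω hω => ?_
    rw [piecewise_eq_of_notMem _ _ _ hω]

/-- By the portmanteau theorem open sets suffice, and for `E`-valued maps the event `X ∈ O` equals
`J X ∈ V` with `V` open. Continuity of `J` plays no role. -/
theorem TendstoInDistribution.of_comp [IsProbabilityMeasure P] [IsProbabilityMeasure P']
    [HasOuterApproxClosed Y] {l : Filter κ} [l.IsCountablyGenerated]
    (hJ : ∀ O, IsOpen O → ∃ V, IsOpen V ∧ ∀ s ∈ E, s ∈ O ↔ J s ∈ V)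
    {X : κ → Ω → S} {X' : Ω' → S} (hXE : ∀ n ω, X n ω ∈ E) (hXE' : ∀ ω, X' ω ∈ E)
    (h : TendstoInDistribution (fun n ω => J (X n ω)) l (fun ω => J (X' ω)) (fun _ => P) P') :
    TendstoInDistribution X l X' (fun _ => P) P' := by
  have hX := fun n => aemeasurable_of_comp hJ (hXE n) (h.forall_aemeasurable n)
  have hX' := aemeasurable_of_comp hJ hXE' h.aemeasurable_limit
  refine ⟨hX, hX', tendsto_of_forall_isOpen_le_liminf' fun O hO => ?_⟩
  obtain ⟨V, hV, hOV⟩ := hJ O hO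
  have h1 := ProbabilityMeasure.le_liminf_measure_open_of_tendsto h.tendsto hV
  simp only [ProbabilityMeasure.coe_mk] at h1 ⊢
  rw [Measure.map_apply_of_aemeasurable h.aemeasurable_limit hV.measurableSet] at h1
  rw [Measure.map_apply_of_aemeasurable hX' hO.measurableSet]
  simp only [Measure.map_apply_of_aemeasurable (h.forall_aemeasurable _) hV.measurableSet] at h1
  simp only [Measure.map_apply_of_aemeasurable (hX _) hO.measurableSet]
  have e : ∀ n, X n ⁻¹' O = (fun ω => J (X n ω)) ⁻¹' V := fun n => by
    ext ω; exact hOV _ (hXE n ω)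
  have e' : X' ⁻¹' O = (fun ω => J (X' ω)) ⁻¹' V := by
    ext ω; exact hOV _ (hXE' ω)
  simpa only [e, e'] using h1

end Transfer

/-! ### Grid values determine the `M₁` topology on nonincreasing paths -/

/-- The values of a path at the points `j/(k+1)`. -/
def gridValues (g : SkorokhodSpace) (p : ℕ × ℕ) : ℝ≥0∞ := g.1 (p.1 * (1 / (p.2 + 1)))

/-- The countable product of copies of `[0,∞]` is first countable, so the sequential statement
`tendsto_distM1Infty_of_antitone` yields neighbourhoods. -/
theorem exists_isOpen_gridValues_preimage (O : Set SkorokhodSpace) (hO : IsOpen O) :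
    ∃ V, IsOpen V ∧ ∀ g ∈ {g : SkorokhodSpace | Antitone g.1}, g ∈ O ↔ gridValues g ∈ V := by
  refine exists_isOpen_preimage_of_nhds (fun g hg O hO hgO => ?_) hO
  obtain ⟨V, hV⟩ := (𝓝 (gridValues g)).exists_antitone_basis
  by_contra! hc
  choose h h1 h2 h3 using fun n => hc (V n) (hV.1.mem_of_mem trivial)
  have h4 := tendsto_pi_nhds.1 (hV.tendsto h2)
  have h5 := tendsto_distM1Infty_of_antitone (g := g) hg (h := h) h1 fun j k => h4 (j, k)
  obtain ⟨ε, hε, h6⟩ := hO g hgO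
  obtain ⟨n, hn⟩ := ((tendsto_order.1 h5).2 ε hε).exists
  exact h3 n (h6 _ hn)

/-! ## Thinned renewal sequences with exponential increments -/

theorem lintegral_expMeasure {θ : ℝ} (g : ℝ → ℝ≥0∞) :
    ∫⁻ x, g x ∂expMeasure θ =
      ∫⁻ x in Ioi 0, ENNReal.ofReal (θ * Real.exp (-(θ * x))) * g x := by
  have h1 : expMeasure θ = (volume.restrict (Ioi 0)).withDensity
      fun x => ENNReal.ofReal (θ * Real.exp (-(θ * x))) := by
    rw [expMeasure, gammaMeasure, restrict_Ioi_eq_restrict_Ici,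
      ← withDensity_indicator measurableSet_Ici]
    congr 1
    ext x
    change exponentialPDF θ x = _
    rw [exponentialPDF_eq]
    by_cases hx : 0 ≤ x
    · rw [if_pos hx, indicator_of_mem (mem_Ici.2 hx)]
    · rw [if_neg hx, indicator_of_notMem (by simpa using hx), ENNReal.ofReal_zero]
  rw [h1, lintegral_withDensity_eq_lintegral_mul_non_measurable _ (by fun_prop)
    (ae_of_all _ fun _ => ENNReal.ofReal_lt_top)]
  rfl

/-- Each exponential step multiplies the mean of `exp(-s)` by `θ/(θ+1) < 1`. This shows that late
arrivals rarely fall below a fixed level. -/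
theorem lintegral_exp_neg_expMeasure {θ : ℝ} (hθ : 0 < θ) (s : ℝ) :
    ∫⁻ x, ENNReal.ofReal (Real.exp (-(s + x))) ∂expMeasure θ =
      ENNReal.ofReal (θ / (θ + 1)) * ENNReal.ofReal (Real.exp (-s)) := by
  have hθ' : 0 < θ + 1 := by linarith
  have := isProbabilityMeasure_expMeasure hθ'
  have h1 := lintegral_expMeasure (θ := θ + 1) (fun _ => 1)
  rw [lintegral_one, measure_univ] at h1
  rw [lintegral_expMeasure]
  have h2 : ∀ x : ℝ, ENNReal.ofReal (θ * Real.exp (-(θ * x))) *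
      ENNReal.ofReal (Real.exp (-(s + x))) =
      ENNReal.ofReal (θ / (θ + 1)) * ENNReal.ofReal (Real.exp (-s)) *
        (ENNReal.ofReal ((θ + 1) * Real.exp (-((θ + 1) * x))) * 1) := by
    intro x
    rw [mul_one, ← ENNReal.ofReal_mul (by positivity), ← ENNReal.ofReal_mul (by positivity),
      ← ENNReal.ofReal_mul (by positivity)]
    congr 1
    have e1 : Real.exp (-(s + x)) = Real.exp (-s) * Real.exp (-x) := by
      rw [← Real.exp_add]; ring_nf
    have e2 : Real.exp (-((θ + 1) * x)) = Real.exp (-(θ * x)) * Real.exp (-x) := by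
      rw [← Real.exp_add]; ring_nf
    rw [e1, e2]
    field_simp
  simp_rw [h2]
  rw [lintegral_const_mul _ (by fun_prop), ← h1, mul_one]

/-- The void probability `s ↦ exp(-θ ∫_s^M π)` is invariant under an exponential step followed by
thinning with retention probability `1 - π`. -/
theorem lintegral_thinning_step {θ : ℝ} (hθ : 0 < θ) {π : ℝ → ℝ} (hπ : Antitone π)
    (h0 : ∀ s, 0 ≤ π s) (h1 : ∀ s, π s ≤ 1) {M : ℝ} (hM : ∀ s, M ≤ s → π s = 0) (s : ℝ) :
    ∫⁻ x, ENNReal.ofReal (1 - π (s + x)) *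
        ENNReal.ofReal (Real.exp (-θ * ∫ r in (s + x)..M, π r)) ∂expMeasure θ =
      ENNReal.ofReal (Real.exp (-θ * ∫ r in s..M, π r)) := by
  have hint : ∀ a b, IntervalIntegrable π volume a b := fun a b => hπ.intervalIntegrable
  set φ : ℝ → ℝ := fun s => Real.exp (-θ * ∫ r in s..M, π r) with hφ
  have hφ1 : ∀ s, φ s ≤ 1 := by
    intro s
    refine Real.exp_le_one_iff.2 ?_
    have : 0 ≤ ∫ r in s..M, π r := by
      rcases le_total s M with h | h
      · exact intervalIntegral.integral_nonneg h fun r _ => h0 r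
      · rw [intervalIntegral.integral_symm, intervalIntegral.integral_zero_ae, neg_zero]
        refine ae_of_all _ fun r hr => hM r ?_
        rw [uIoc_of_le h] at hr
        exact hr.1.le
    nlinarith
  have hcont : Continuous φ := by
    refine Real.continuous_exp.comp (continuous_const.mul ?_)
    have := (intervalIntegral.continuous_primitive hint M).neg
    refine this.congr fun s => ?_
    rw [Pi.neg_apply, intervalIntegral.integral_symm]
    simp
  have hderiv : ∀ x, ContinuousAt π x → HasDerivAt φ (φ x * (θ * π x)) x := by
    intro x hx
    have := (intervalIntegral.integral_hasDerivAt_left (hint x M)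
      hπ.measurable.stronglyMeasurable.stronglyMeasurableAtFilter hx).const_mul (-θ)
    convert this.exp using 1
    ring
  set G : ℝ → ℝ := fun x => θ * Real.exp (-(θ * x)) * ((1 - π (s + x)) * φ (s + x)) with hG
  have hG0 : ∀ x, 0 ≤ G x := fun x =>
    mul_nonneg (by positivity) (mul_nonneg (by linarith [h1 (s + x)]) (Real.exp_pos _).le)
  have hmeasπ : Measurable π := hπ.measurable
  have hmeasφ : Measurable φ := hcont.measurable
  have hGmeas : Measurable G := by fun_prop
  have hGle : ∀ x, G x ≤ θ * Real.exp (-(θ * x)) := by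
    intro x
    have a1 : (1 - π (s + x)) * φ (s + x) ≤ 1 :=
      mul_le_one₀ (by linarith [h0 (s + x)]) (Real.exp_pos _).le (hφ1 _)
    exact mul_le_of_le_one_right (by positivity) a1
  have hdom : IntegrableOn (fun x => θ * Real.exp (-(θ * x))) (Ioi 0) := by
    have := (exp_neg_integrableOn_Ioi 0 hθ).const_mul θ
    simpa only [neg_mul, IntegrableOn] using this
  have hGint : IntegrableOn G (Ioi 0) := by
    refine Integrable.mono' hdom hGmeas.aestronglyMeasurable (ae_of_all _ fun x => ?_)
    rw [Real.norm_of_nonneg (hG0 x)]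
    exact hGle x
  -- `G` is the derivative of `x ↦ -exp(-θ x) φ(s + x)` wherever `π` is continuous at `s + x`, that
  -- is, off a countable set, because `φ' = θ π φ` there.
  have hFTC : ∀ R : ℝ, 0 ≤ R →
      ∫ x in (0 : ℝ)..R, G x = φ s - Real.exp (-(θ * R)) * φ (s + R) := by
    intro R hR
    have key := integral_eq_of_hasDerivAt_off_countable_of_le
      (fun x => -(Real.exp (-(θ * x)) * φ (s + x))) G hR
      (s := (fun x => s + x) ⁻¹' {y | ¬ContinuousAt π y})
      (hπ.countable_not_continuousAt.preimage (add_right_injective s))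
      (by fun_prop) (fun x hx => ?_)
      ((intervalIntegrable_iff_integrableOn_Ioc_of_le hR).2
        (hGint.mono_set Ioc_subset_Ioi_self))
    · rw [key]
      simp
      ring
    · have hx' : ContinuousAt π (s + x) := by
        by_contra h
        exact hx.2 h
      have e1 : HasDerivAt (fun x => φ (s + x)) (φ (s + x) * (θ * π (s + x))) x :=
        (hderiv _ hx').comp_const_add s x
      have e2 : HasDerivAt (fun x => Real.exp (-(θ * x))) (Real.exp (-(θ * x)) * (-(θ * 1))) x :=
        (((hasDerivAt_id x).const_mul θ).neg).exp
      refine (e2.mul e1).neg.congr_deriv ?_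
      simp only [hG]
      ring
  have hlim : ∫ x in Ioi 0, G x = φ s := by
    refine tendsto_nhds_unique (intervalIntegral_tendsto_integral_Ioi 0 hGint tendsto_id) ?_
    have e3 : Tendsto (fun R : ℝ => Real.exp (-(θ * R)) * φ (s + R)) atTop (𝓝 0) := by
      refine squeeze_zero (fun R => by positivity)
        (fun R => mul_le_of_le_one_right (Real.exp_pos _).le (hφ1 _)) ?_
      exact Real.tendsto_exp_neg_atTop_nhds_zero.comp (tendsto_id.const_mul_atTop hθ)
    have e4 := e3.const_sub (φ s)
    rw [sub_zero] at e4
    refine e4.congr' ?_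
    filter_upwards [eventually_ge_atTop 0] with R hR
    exact (hFTC R hR).symm
  change _ = ENNReal.ofReal (φ s)
  rw [lintegral_expMeasure, ← hlim, ofReal_integral_eq_lintegral_ofReal hGint (ae_of_all _ hG0)]
  refine lintegral_congr fun x => ?_
  rw [← ENNReal.ofReal_mul (by linarith [h1 (s + x)]), ← ENNReal.ofReal_mul (by positivity)]

/-! ### Expectations of products along a renewal sequence -/

section Renewal

variable {Ω : Type*} [MeasurableSpace Ω] {P : Measure Ω} [IsProbabilityMeasure P] {θ : ℝ}
  {τ : ℕ → Ω → ℝ}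

/-- A Markov property argument: the increment `τ J` is independent of the first `J` increments, so
integrating it out produces a factor `a` by `hstep`. -/
theorem lintegral_prod_renewal (hlaw : ∀ j, HasLaw (τ j) (expMeasure θ) P) (hind : iIndepFun τ P)
    {k φ : ℝ → ℝ≥0∞} (hk : Measurable k) (hφ : Measurable φ) {a : ℝ≥0∞}
    (hstep : ∀ s, ∫⁻ x, k (s + x) * φ (s + x) ∂expMeasure θ = a * φ s) (J : ℕ) :
    ∫⁻ ω, (∏ j ∈ Finset.range J, k (∑ l ∈ Finset.range (j + 1), τ l ω)) *
      φ (∑ l ∈ Finset.range J, τ l ω) ∂P = a ^ J * φ 0 := by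
  have hτ : ∀ j, AEMeasurable (τ j) P := fun j => (hlaw j).aemeasurable
  induction J with
  | zero => simp
  | succ J ih =>
    set R : Ω → ℝ≥0∞ × ℝ := fun ω =>
      (∏ j ∈ Finset.range J, k (∑ l ∈ Finset.range (j + 1), τ l ω),
        ∑ l ∈ Finset.range J, τ l ω) with hR
    have hRm : AEMeasurable R P := by
      refine AEMeasurable.prodMk ?_ ?_
      · exact Finset.aemeasurable_fun_prod _ fun j _ => hk.comp_aemeasurable
          (Finset.aemeasurable_fun_sum _ fun l _ => hτ l)
      · exact Finset.aemeasurable_fun_sum _ fun l _ => hτ l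
    have hindep : IndepFun R (τ J) P := by
      have h1 := hind.indepFun_finset₀ (Finset.range J) {J} (by simp) hτ
      let e : (Finset.range J → ℝ) → ℕ → ℝ := fun x l =>
        if h : l ∈ Finset.range J then x ⟨l, h⟩ else 0
      have he : Measurable e := by
        refine measurable_pi_lambda _ fun l => ?_
        by_cases h : l ∈ Finset.range J
        · simpa only [e, dif_pos h] using measurable_pi_apply _
        · simpa only [e, dif_neg h] using measurable_const
      have hψ : Measurable fun x : ({J} : Finset ℕ) → ℝ => x ⟨J, Finset.mem_singleton_self J⟩ :=
        measurable_pi_apply _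
      have h2 := h1.comp (φ := fun x => (∏ j ∈ Finset.range J,
        k (∑ l ∈ Finset.range (j + 1), e x l), ∑ l ∈ Finset.range J, e x l))
        (by fun_prop) hψ
      refine h2.congr (ae_of_all _ fun ω => ?_) (ae_of_all _ fun ω => rfl)
      have h3 : ∀ l ∈ Finset.range J, e (fun i => τ i ω) l = τ l ω := fun l hl => dif_pos hl
      simp only [Function.comp_apply, hR]
      congr 1
      · refine Finset.prod_congr rfl fun j hj => ?_
        congr 1
        refine Finset.sum_congr rfl fun l hl => h3 l ?_
        simp only [Finset.mem_range] at hj hl ⊢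
        omega
      · exact Finset.sum_congr rfl h3
    set f : (ℝ≥0∞ × ℝ) × ℝ → ℝ≥0∞ := fun q => q.1.1 * (k (q.1.2 + q.2) * φ (q.1.2 + q.2)) with hf
    have hfm : Measurable f := by fun_prop
    have hkφ : Measurable fun q : ℝ × ℝ => k (q.1 + q.2) * φ (q.1 + q.2) := by fun_prop
    calc _ = ∫⁻ ω, f (R ω, τ J ω) ∂P := by
          refine lintegral_congr fun ω => ?_
          simp only [hf, hR]
          rw [Finset.prod_range_succ, Finset.sum_range_succ]
          ring
      _ = ∫⁻ q, f q ∂(P.map R).prod (P.map (τ J)) := by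
          rw [← (indepFun_iff_map_prod_eq_prod_map_map hRm (hτ J)).1 hindep,
            lintegral_map' hfm.aemeasurable (hRm.prodMk (hτ J))]
      _ = ∫⁻ r, ∫⁻ x, f (r, x) ∂expMeasure θ ∂P.map R := by
          have := Measure.isProbabilityMeasure_map (hτ J)
          rw [lintegral_prod _ hfm.aemeasurable, (hlaw J).map_eq]
      _ = ∫⁻ r, a * (r.1 * φ r.2) ∂P.map R := by
          refine lintegral_congr fun r => ?_
          simp only [hf]
          rw [lintegral_const_mul _ (by fun_prop), hstep]
          ring
      _ = a ^ (J + 1) * φ 0 := by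
          rw [lintegral_const_mul _ (by fun_prop), lintegral_map' (by fun_prop) hRm, pow_succ',
            mul_assoc, ← ih]

/-- Weighted by `φ(S_J)`, with `S_J` the sum of the first `J` increments, the product has mean `φ 0`
for every `J`. The weight is `1` once `S_J ≥ M`, and otherwise the error is at most `exp(M - S_J)`,
whose mean is `exp(M) (θ/(θ+1))^J`. -/
theorem tendsto_lintegral_prod_thinning (hθ : 0 < θ)
    (hlaw : ∀ j, HasLaw (τ j) (expMeasure θ) P) (hind : iIndepFun τ P)
    {π : ℝ → ℝ} (hπ : Antitone π) (h0 : ∀ s, 0 ≤ π s) (h1 : ∀ s, π s ≤ 1) {M : ℝ}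
    (hM : ∀ s, M ≤ s → π s = 0) :
    Tendsto (fun J => ∫⁻ ω, ∏ j ∈ Finset.range J,
      ENNReal.ofReal (1 - π (∑ l ∈ Finset.range (j + 1), τ l ω)) ∂P) atTop
      (𝓝 (ENNReal.ofReal (Real.exp (-θ * ∫ r in (0 : ℝ)..M, π r)))) := by
  have hτ : ∀ j, AEMeasurable (τ j) P := fun j => (hlaw j).aemeasurable
  have hS : ∀ J, AEMeasurable (fun ω => ∑ l ∈ Finset.range J, τ l ω) P := fun J =>
    Finset.aemeasurable_fun_sum _ fun l _ => hτ l
  have hπm : Measurable π := hπ.measurable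
  set φ : ℝ → ℝ≥0∞ := fun s => ENNReal.ofReal (Real.exp (-θ * ∫ r in s..M, π r)) with hφ
  have hφm : Measurable φ := by
    have : Continuous fun s => ∫ r in s..M, π r := by
      refine (intervalIntegral.continuous_primitive (μ := volume)
        (fun a b => hπ.intervalIntegrable) M).neg.congr fun s => ?_
      rw [Pi.neg_apply, intervalIntegral.integral_symm]
      simp
    have := this.measurable
    fun_prop
  have hφM : ∀ s, M ≤ s → φ s = 1 := by
    intro s hs
    simp only [hφ]
    rw [intervalIntegral.integral_symm, intervalIntegral.integral_zero_ae]
    · simp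
    · refine ae_of_all _ fun r hr => hM r ?_
      rw [uIoc_of_le hs] at hr
      exact hr.1.le
  have hφ1 : ∀ s, φ s ≤ 1 := by
    intro s
    rcases le_total s M with hs | hs
    · refine ENNReal.ofReal_le_one.2 (Real.exp_le_one_iff.2 ?_)
      have := intervalIntegral.integral_nonneg (μ := volume) hs fun r _ => h0 r
      nlinarith
    · exact (hφM s hs).le
  set R : ℕ → Ω → ℝ≥0∞ := fun J ω => ∏ j ∈ Finset.range J,
      ENNReal.ofReal (1 - π (∑ l ∈ Finset.range (j + 1), τ l ω)) with hR
  have hR1 : ∀ J ω, R J ω ≤ 1 := fun J ω => Finset.prod_le_one' fun j _ =>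
    ENNReal.ofReal_le_one.2 (by linarith [h0 (∑ l ∈ Finset.range (j + 1), τ l ω)])
  have hb : ∀ J, ∫⁻ ω, R J ω * φ (∑ l ∈ Finset.range J, τ l ω) ∂P = φ 0 := fun J => by
    have := lintegral_prod_renewal hlaw hind (k := fun s => ENNReal.ofReal (1 - π s)) (φ := φ)
      (a := 1) (by fun_prop) hφm
      (fun s => by rw [one_mul]; exact lintegral_thinning_step hθ hπ h0 h1 hM s) J
    simpa using this
  have hc : ∀ J, ∫⁻ ω, ENNReal.ofReal (Real.exp (-(∑ l ∈ Finset.range J, τ l ω))) ∂P =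
      ENNReal.ofReal (θ / (θ + 1)) ^ J := fun J => by
    have := lintegral_prod_renewal hlaw hind (k := fun _ => 1)
      (φ := fun s => ENNReal.ofReal (Real.exp (-s))) measurable_const (by fun_prop)
      (fun s => by simpa using lintegral_exp_neg_expMeasure hθ s) J
    simpa using this
  have hupper : Tendsto (fun J : ℕ => φ 0 + ENNReal.ofReal (Real.exp M) *
      ENNReal.ofReal (θ / (θ + 1)) ^ J) atTop (𝓝 (φ 0)) := by
    have h2 : ENNReal.ofReal (θ / (θ + 1)) < 1 :=
      ENNReal.ofReal_lt_one.2 ((div_lt_one (by linarith)).2 (by linarith))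
    have h3 := ENNReal.Tendsto.const_mul (ENNReal.tendsto_pow_atTop_nhds_zero_of_lt_one h2)
      (Or.inr (ENNReal.ofReal_ne_top (r := Real.exp M)))
    simpa using h3.const_add (φ 0)
  refine tendsto_of_tendsto_of_tendsto_of_le_of_le tendsto_const_nhds hupper (fun J => ?_)
    (fun J => ?_)
  · change φ 0 ≤ ∫⁻ ω, R J ω ∂P
    rw [← hb J]
    exact lintegral_mono fun ω => mul_le_of_le_one_right zero_le (hφ1 _)
  · change ∫⁻ ω, R J ω ∂P ≤ _
    rw [← hc J, ← lintegral_const_mul'' _ (by have := hS J; fun_prop)]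
    rw [← hb J, ← lintegral_add_right' _ (by have := hS J; fun_prop)]
    refine lintegral_mono fun ω => ?_
    rcases le_total M (∑ l ∈ Finset.range J, τ l ω) with h | h
    · rw [hφM _ h, mul_one]
      exact le_self_add
    · refine le_add_left ((hR1 J ω).trans ?_)
      rw [← ENNReal.ofReal_mul (Real.exp_pos _).le, ← Real.exp_add, ← ENNReal.ofReal_one]
      exact ENNReal.ofReal_le_ofReal (Real.one_le_exp (by linarith))

end Renewal

/-! ### Void probabilities of Poisson points built strip by strip -/

section PoissonVoid

variable {Ω : Type*} [MeasurableSpace Ω] {P : Measure Ω}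

theorem iIndepFun_rows {ι κ : Type*} [Countable ι] [Countable κ] {X : ι × κ → Ω → ℝ}
    (hX : ∀ p, AEMeasurable (X p) P) (hind : iIndepFun X P) :
    iIndepFun (fun i ω j => X (i, j) ω) P := by
  have := hind.isProbabilityMeasure
  have hp : ∀ p, IsProbabilityMeasure (P.map (X p)) := fun p =>
    Measure.isProbabilityMeasure_map (hX p)
  have hrow : ∀ i, AEMeasurable (fun ω j => X (i, j) ω) P := fun i =>
    aemeasurable_pi_iff.2 fun j => hX (i, j)
  rw [iIndepFun_iff_map_fun_eq_infinitePi_map₀' hrow]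
  have h1 : ∀ i, P.map (fun ω j => X (i, j) ω) =
      Measure.infinitePi fun j => P.map (X (i, j)) := fun i =>
    (hind.precomp (g := fun j => (i, j)) (Prod.mk_right_injective i)).map_fun_eq_infinitePi_map₀'
      fun j => hX (i, j)
  simp_rw [h1]
  rw [← Measure.infinitePi_map_curry (fun i j => P.map (X (i, j))),
    ← hind.map_fun_eq_infinitePi_map₀' hX,
    AEMeasurable.map_map_of_aemeasurable (MeasurableEquiv.measurable _).aemeasurable
      (aemeasurable_pi_iff.2 hX)]
  rfl

theorem lintegral_prod_eq_prod_lintegral_of_iIndepFun {ι : Type*} (s : Finset ι)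
    {β : ι → Type*} [∀ i, MeasurableSpace (β i)] {X : ∀ i, Ω → β i}
    (hX : ∀ i, AEMeasurable (X i) P) (hind : iIndepFun X P) {f : ∀ i, β i → ℝ≥0∞}
    (hf : ∀ i, Measurable (f i)) :
    ∫⁻ ω, ∏ i ∈ s, f i (X i ω) ∂P = ∏ i ∈ s, ∫⁻ ω, f i (X i ω) ∂P := by
  have h1 : ∀ i, (fun ω => f i (X i ω)) =ᵐ[P] fun ω => f i ((hX i).mk _ ω) := fun i =>
    (hX i).ae_eq_mk.fun_comp (f i)
  have h2 := lintegral_prod_eq_prod_lintegral_of_indepFun s (fun i ω => f i ((hX i).mk _ ω))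
    ((hind.congr fun i => (hX i).ae_eq_mk).comp f hf)
    (fun i => (hf i).comp (hX i).measurable_mk)
  have h3 : ∀ᵐ ω ∂P, ∀ i ∈ s, f i (X i ω) = f i ((hX i).mk _ ω) :=
    (Finset.eventually_all s).2 fun i _ => h1 i
  rw [Finset.prod_congr rfl fun i _ => lintegral_congr_ae (h1 i), ← h2]
  refine lintegral_congr_ae ?_
  filter_upwards [h3] with ω hω
  exact Finset.prod_congr rfl hω

/-- The length of the part of `(k, k+1]` that lies below `c`. -/
def stripLength (k : ℕ) (c : ℝ) : ℝ := min 1 (max 0 (c - k))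

theorem stripLength_nonneg (k : ℕ) (c : ℝ) : 0 ≤ stripLength k c :=
  le_min zero_le_one (le_max_left _ _)

theorem stripLength_le_one (k : ℕ) (c : ℝ) : stripLength k c ≤ 1 := min_le_left _ _

theorem stripLength_mono (k : ℕ) : Monotone (stripLength k) := fun _ _ h => by
  unfold stripLength; gcongr

theorem sum_stripLength {I : ℕ} {c : ℝ} (h0 : 0 ≤ c) :
    ∑ k ∈ Finset.range I, stripLength k c = min (I : ℝ) c := by
  induction I with
  | zero => simp [h0]
  | succ I ih =>
    rw [Finset.sum_range_succ, ih, stripLength]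
    push_cast
    rcases le_total c I with h | h
    · rw [min_eq_right h, max_eq_left (by linarith), min_eq_right zero_le_one,
        min_eq_right (by linarith), add_zero]
    · rw [min_eq_left h, max_eq_right (by linarith)]
      rcases le_total c (I + 1) with h' | h'
      · rw [min_eq_right (by linarith), min_eq_right h']; ring
      · rw [min_eq_left (by linarith), min_eq_left h']

theorem measure_le_uniform {V : Ω → ℝ} {k : ℕ}
    (hV : HasLaw V (volume.restrict (Ioc (k : ℝ) (k + 1))) P) (c : ℝ) :
    P {ω | c ≤ V ω} = ENNReal.ofReal (1 - stripLength k c) := by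
  have h0 : MeasurableSet {x : ℝ | c ≤ x} := measurableSet_Ici
  rw [hV.measure_eq h0, Measure.restrict_apply h0, stripLength]
  have h1 : (volume : Measure ℝ) ({x | c ≤ x} ∩ Ioc (k : ℝ) (k + 1)) =
      volume (Ioc (max c k) ((k : ℝ) + 1)) := by
    refine measure_congr ?_
    have : ({x | c ≤ x} : Set ℝ) =ᵐ[volume] Ioi c := Ioi_ae_eq_Ici.symm
    refine (this.inter (ae_eq_refl (Ioc (k : ℝ) (k + 1)))).trans (ae_of_all _ fun x => ?_)
    simp only [eq_iff_iff]
    change (x ∈ Ioi c ∩ Ioc (k : ℝ) (k + 1)) ↔ x ∈ Ioc (max c k) ((k : ℝ) + 1)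
    simp only [mem_inter_iff, mem_Ioi, mem_Ioc, max_lt_iff]
    tauto
  rw [h1, Real.volume_Ioc]
  rcases le_total c k with h | h
  · rw [max_eq_right h, max_eq_left (by linarith), min_eq_right zero_le_one]
    congr 1; ring
  · rw [max_eq_left h, max_eq_right (by linarith)]
    rcases le_total c (k + 1) with h' | h'
    · rw [min_eq_right (by linarith)]
      congr 1; ring
    · rw [min_eq_left (by linarith), ENNReal.ofReal_of_nonpos (by linarith),
        ENNReal.ofReal_of_nonpos (by linarith)]

variable {θ : ℝ} {τ V : ℕ × ℕ → Ω → ℝ}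

/-- The arrival times of a family of renewal sequences. -/
def arrivalTime (x : ℕ × ℕ → ℝ) (p : ℕ × ℕ) : ℝ := ∑ l ∈ Finset.range (p.2 + 1), x (p.1, l)

theorem measurable_arrivalTime (p : ℕ × ℕ) : Measurable fun x => arrivalTime x p := by
  unfold arrivalTime; fun_prop

/-- Fubini: given all arrival times, the heights are independent and uniform on their strips, so the
conditional probability is a product. -/
theorem measure_forall_le_eq_lintegral (hτm : ∀ p, AEMeasurable (τ p) P)
    (hV : ∀ p, HasLaw (V p) (volume.restrict (Ioc (p.1 : ℝ) ((p.1 : ℝ) + 1))) P)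
    (hVind : iIndepFun V P) (hτV : IndepFun (fun ω p => τ p ω) (fun ω p => V p ω) P)
    {h : ℝ → ℝ} (hh : Measurable h) (s : Finset (ℕ × ℕ)) :
    P {ω | ∀ p ∈ s, h (arrivalTime (fun p => τ p ω) p) ≤ V p ω} =
      ∫⁻ ω, ∏ p ∈ s,
        ENNReal.ofReal (1 - stripLength p.1 (h (arrivalTime (fun p => τ p ω) p))) ∂P := by
  have := hVind.isProbabilityMeasure
  have hVm : ∀ p, AEMeasurable (V p) P := fun p => (hV p).aemeasurable
  have hτ' : AEMeasurable (fun ω p => τ p ω) P := aemeasurable_pi_iff.2 hτm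
  have hV' : AEMeasurable (fun ω p => V p ω) P := aemeasurable_pi_iff.2 hVm
  set B : Set ((ℕ × ℕ → ℝ) × (ℕ × ℕ → ℝ)) := {q | ∀ p ∈ s, h (arrivalTime q.1 p) ≤ q.2 p}
  have hB : MeasurableSet B := by
    have : B = ⋂ p ∈ s, {q | h (arrivalTime q.1 p) ≤ q.2 p} := by ext; simp [B]
    rw [this]
    refine s.measurableSet_biInter fun p _ => measurableSet_le ?_ (by fun_prop)
    exact hh.comp ((measurable_arrivalTime p).comp measurable_fst)
  have h1 : P {ω | ∀ p ∈ s, h (arrivalTime (fun p => τ p ω) p) ≤ V p ω} =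
      (P.map fun ω => ((fun p => τ p ω), (fun p => V p ω))) B :=
    (Measure.map_apply_of_aemeasurable (hτ'.prodMk hV') hB).symm
  have := Measure.isProbabilityMeasure_map hV'
  rw [h1, (indepFun_iff_map_prod_eq_prod_map_map hτ' hV').1 hτV, Measure.prod_apply hB]
  have hsl : ∀ k, Measurable (stripLength k) := fun k => (stripLength_mono k).measurable
  have h2 : ∀ x : ℕ × ℕ → ℝ, (P.map fun ω p => V p ω) (Prod.mk x ⁻¹' B) =
      ∏ p ∈ s, ENNReal.ofReal (1 - stripLength p.1 (h (arrivalTime x p))) := by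
    intro x
    rw [Measure.map_apply_of_aemeasurable hV' (measurable_prodMk_left hB)]
    have h3 : (fun ω p => V p ω) ⁻¹' (Prod.mk x ⁻¹' B) =
        ⋂ p ∈ s, {ω | h (arrivalTime x p) ≤ V p ω} := by ext; simp [B]
    rw [h3]
    refine (hVind.meas_biInter (s := fun p => {ω | h (arrivalTime x p) ≤ V p ω}) fun p _ =>
      ⟨Ici (h (arrivalTime x p)), measurableSet_Ici, rfl⟩).trans ?_
    exact Finset.prod_congr rfl fun p _ => measure_le_uniform (hV p) _
  simp_rw [h2]
  rw [lintegral_map' _ hτ']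
  refine Measurable.aemeasurable (Finset.measurable_fun_prod _ fun p _ => ?_)
  have := (hsl p.1).comp (hh.comp (measurable_arrivalTime p))
  exact (this.const_sub 1).ennreal_ofReal

/-- The void probability of the region below a decreasing function `h` for the points
`(T_{k,j}, U_{k,j})`, where for each `k` the `T_{k,·}` are the points of a Poisson process of rate
`θ` and the `U_{k,·}` are uniform on `(k,k+1]`. -/
theorem measure_forall_le_arrivalTime (hθ : 0 < θ)
    (hlaw : ∀ p, HasLaw (τ p) (expMeasure θ) P) (hind : iIndepFun τ P)
    (hV : ∀ p, HasLaw (V p) (volume.restrict (Ioc (p.1 : ℝ) ((p.1 : ℝ) + 1))) P)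
    (hVind : iIndepFun V P) (hτV : IndepFun (fun ω p => τ p ω) (fun ω p => V p ω) P)
    {h : ℝ → ℝ} (hh : Antitone h) (h0 : ∀ s, 0 ≤ h s) {I : ℕ} (hI : ∀ s, h s ≤ I) {M : ℝ}
    (hM : ∀ s, M ≤ s → h s = 0) :
    P {ω | ∀ p, h (arrivalTime (fun p => τ p ω) p) ≤ V p ω} =
      ENNReal.ofReal (Real.exp (-θ * ∫ r in (0 : ℝ)..M, h r)) := by
  have := hind.isProbabilityMeasure
  have hτm : ∀ p, AEMeasurable (τ p) P := fun p => (hlaw p).aemeasurable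
  set π : ℕ → ℝ → ℝ := fun k s => stripLength k (h s) with hπdef
  have hπ : ∀ k, Antitone (π k) := fun k => (stripLength_mono k).comp_antitone hh
  have hrows := iIndepFun_rows hτm hind
  have hprob : ∀ J, P {ω | ∀ p ∈ Finset.range I ×ˢ Finset.range J,
      h (arrivalTime (fun p => τ p ω) p) ≤ V p ω} =
      ∏ k ∈ Finset.range I, ∫⁻ ω, ∏ j ∈ Finset.range J,
        ENNReal.ofReal (1 - π k (∑ l ∈ Finset.range (j + 1), τ (k, l) ω)) ∂P := by
    intro J
    rw [measure_forall_le_eq_lintegral hτm hV hVind hτV hh.measurable,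
      ← lintegral_prod_eq_prod_lintegral_of_iIndepFun (Finset.range I)
        (X := fun k ω l => τ (k, l) ω) (fun k => aemeasurable_pi_iff.2 fun l => hτm (k, l)) hrows
        (f := fun k x => ∏ j ∈ Finset.range J,
          ENNReal.ofReal (1 - π k (∑ l ∈ Finset.range (j + 1), x l)))
        (fun k => by have := (hπ k).measurable; fun_prop)]
    refine lintegral_congr fun ω => ?_
    rw [Finset.prod_product]
    rfl
  have hlim1 : Tendsto (fun J => P {ω | ∀ p ∈ Finset.range I ×ˢ Finset.range J,
      h (arrivalTime (fun p => τ p ω) p) ≤ V p ω}) atTop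
      (𝓝 (∏ k ∈ Finset.range I, ENNReal.ofReal (Real.exp (-θ * ∫ r in (0 : ℝ)..M, π k r)))) := by
    simp_rw [hprob]
    refine ENNReal.tendsto_finsetProd_of_ne_top _ (fun k _ => ?_)
      (fun k _ => ENNReal.ofReal_ne_top)
    exact tendsto_lintegral_prod_thinning hθ (fun j => hlaw (k, j))
      (hind.precomp (g := fun j => (k, j)) (Prod.mk_right_injective k)) (hπ k)
      (fun s => stripLength_nonneg _ _) (fun s => stripLength_le_one _ _)
      (fun s hs => by simp [π, hM s hs, stripLength])
  have hlim2 := tendsto_measure_iInter_atTop (μ := P) (s := fun J : ℕ =>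
      {ω | ∀ p ∈ Finset.range I ×ˢ Finset.range J, h (arrivalTime (fun p => τ p ω) p) ≤ V p ω})
    (fun J => by
      have : {ω | ∀ p ∈ Finset.range I ×ˢ Finset.range J,
          h (arrivalTime (fun p => τ p ω) p) ≤ V p ω} =
          ⋂ p ∈ Finset.range I ×ˢ Finset.range J,
            {ω | h (arrivalTime (fun p => τ p ω) p) ≤ V p ω} := by ext; simp
      rw [this]
      refine Finset.nullMeasurableSet_biInter _ fun p _ => nullMeasurableSet_le ?_
        (hV p).aemeasurable
      exact hh.measurable.comp_aemeasurable
        ((measurable_arrivalTime p).comp_aemeasurable (aemeasurable_pi_iff.2 hτm)))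
    (fun J J' hJ ω hω p hp => hω p (by
      simp only [Finset.mem_product, Finset.mem_range] at hp ⊢
      exact ⟨hp.1, hp.2.trans_le hJ⟩))
    ⟨0, measure_ne_top _ _⟩
  -- The parts of `[0, h r]` in the first `I` strips add up to `h r`, since `h ≤ I`.
  have hprod : ∏ k ∈ Finset.range I, ENNReal.ofReal (Real.exp (-θ * ∫ r in (0 : ℝ)..M, π k r)) =
      ENNReal.ofReal (Real.exp (-θ * ∫ r in (0 : ℝ)..M, h r)) := by
    rw [← ENNReal.ofReal_prod_of_nonneg fun _ _ => (Real.exp_pos _).le, ← Real.exp_sum,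
      ← Finset.mul_sum, ← intervalIntegral.integral_finsetSum
        fun k _ => (hπ k).intervalIntegrable]
    congr 4
    ext r
    rw [sum_stripLength (h0 r), min_eq_right (hI r)]
  rw [← hprod, ← tendsto_nhds_unique hlim2 hlim1]
  -- Strips with index at least `I` lie above `h`, so the first `I` strips almost surely decide the
  -- event.
  have hVk : ∀ᵐ ω ∂P, ∀ p : ℕ × ℕ, (p.1 : ℝ) < V p ω := by
    refine ae_all_iff.2 fun p => ?_
    rw [(hV p).ae_iff (p := fun x => (p.1 : ℝ) < x) measurableSet_Ioi.mem]
    exact (ae_restrict_mem measurableSet_Ioc).mono fun x hx => hx.1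
  refine measure_congr ?_
  filter_upwards [hVk] with ω hω
  refine eq_iff_iff.2 ⟨fun H => mem_iInter.2 fun J p _ => H p, fun H p => ?_⟩
  rcases lt_or_ge p.1 I with hp | hp
  · exact mem_iInter.1 H (p.2 + 1) p (by simp [hp])
  · exact (hI _).trans ((Nat.cast_le.2 hp).trans (hω p).le)

end PoissonVoid

/-! ## Unions of rectangles `[0,t_i) × [0,y_i)` -/

section Staircase

variable {ι : Type*}

/-- The height at time `s` of the union of the rectangles `[0,t_i) × [0,y_i)`, `i ∈ F`. -/
def stepHeight (F : Finset ι) (t y : ι → ℝ≥0) (s : ℝ) : ℝ :=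
  (F.sup fun i => if s < t i then y i else 0 : ℝ≥0)

/-- The area of the union of the rectangles `[0,t_i) × [0,y_i)`, `i ∈ F`. -/
def stepArea (F : Finset ι) (t y : ι → ℝ≥0) : ℝ :=
  ∫ s in (0 : ℝ)..(F.sup t : ℝ≥0), stepHeight F t y s

variable (F : Finset ι) (t y : ι → ℝ≥0)

theorem stepHeight_le_iff {s : ℝ} {v : ℝ≥0} :
    stepHeight F t y s ≤ v ↔ ∀ i ∈ F, s < t i → y i ≤ v := by
  rw [stepHeight, NNReal.coe_le_coe, Finset.sup_le_iff]
  refine forall₂_congr fun i _ => ?_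
  split_ifs with h <;> simp [h]

theorem stepHeight_nonneg (s : ℝ) : 0 ≤ stepHeight F t y s := NNReal.coe_nonneg _

theorem stepHeight_antitone : Antitone (stepHeight F t y) := fun a b hab => by
  refine NNReal.coe_le_coe.2 (Finset.sup_mono_fun fun i _ => ?_)
  split_ifs with h1 h2
  · exact le_rfl
  · exact absurd (hab.trans_lt h1) h2
  · exact zero_le
  · exact le_rfl

theorem stepHeight_le_sup (s : ℝ) : stepHeight F t y s ≤ (F.sup y : ℝ≥0) :=
  (stepHeight_le_iff F t y).2 fun _ hi _ => Finset.le_sup hi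

theorem stepHeight_eq_zero {s : ℝ} (hs : (F.sup t : ℝ≥0) ≤ s) : stepHeight F t y s = 0 := by
  refine le_antisymm ?_ (stepHeight_nonneg _ _ _ _)
  refine (stepHeight_le_iff F t y (v := 0)).2 fun i hi h => absurd h (not_lt.2 ?_)
  exact (NNReal.coe_le_coe.2 (Finset.le_sup hi)).trans hs

theorem stepArea_eq {M : ℝ} (hM : (F.sup t : ℝ≥0) ≤ M) :
    stepArea F t y = ∫ s in (0 : ℝ)..M, stepHeight F t y s := by
  have hint : ∀ a b, IntervalIntegrable (stepHeight F t y) volume a b := fun a b =>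
    (stepHeight_antitone F t y).intervalIntegrable
  have h0 : ∫ s in ((F.sup t : ℝ≥0) : ℝ)..M, stepHeight F t y s = 0 := by
    refine intervalIntegral.integral_zero_ae
      (ae_of_all _ fun s hs => stepHeight_eq_zero F t y ?_)
    rw [uIoc_of_le hM] at hs
    exact hs.1.le
  rw [stepArea, ← intervalIntegral.integral_add_adjacent_intervals (hint 0 (F.sup t : ℝ≥0))
    (hint _ M), h0, add_zero]

theorem stepArea_congr {ι' : Type*} {F' : Finset ι'} {t' y' : ι' → ℝ≥0}
    (h : ∀ s : ℝ, 0 ≤ s → stepHeight F t y s = stepHeight F' t' y' s) :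
    stepArea F t y = stepArea F' t' y' := by
  rw [stepArea_eq F t y (M := max (F.sup t : ℝ≥0) (F'.sup t' : ℝ≥0)) (le_max_left _ _),
    stepArea_eq F' t' y' (le_max_right (F.sup t : ℝ≥0) (F'.sup t' : ℝ≥0) : _ ≤ _)]
  refine intervalIntegral.integral_congr fun s hs => h s ?_
  rw [uIcc_of_le ((NNReal.coe_nonneg _).trans (le_max_left _ _))] at hs
  exact hs.1

/-- The area of a finite union of rectangles depends continuously on the rectangles. -/
theorem tendsto_stepArea {κ : Type*} {l : Filter κ} [l.IsCountablyGenerated]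
    {t' y' : κ → ι → ℝ≥0} (ht : ∀ i ∈ F, Tendsto (fun n => t' n i) l (𝓝 (t i)))
    (hy : ∀ i ∈ F, Tendsto (fun n => y' n i) l (𝓝 (y i))) :
    Tendsto (fun n => stepArea F (t' n) (y' n)) l (𝓝 (stepArea F t y)) := by
  set M : ℝ := (F.sup t : ℝ≥0) + 1 with hM
  have h1 : ∀ᶠ n in l, ((F.sup (t' n) : ℝ≥0) : ℝ) ≤ M := by
    have : Tendsto (fun n => ((F.sup (t' n) : ℝ≥0) : ℝ)) l (𝓝 (F.sup t : ℝ≥0)) :=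
      NNReal.tendsto_coe.2 (Tendsto.finset_sup_nhds_apply ht)
    exact this.eventually_le_const (by linarith)
  have h2 : ∀ᶠ n in l, ((F.sup (y' n) : ℝ≥0) : ℝ) ≤ (F.sup y : ℝ≥0) + 1 := by
    have : Tendsto (fun n => ((F.sup (y' n) : ℝ≥0) : ℝ)) l (𝓝 (F.sup y : ℝ≥0)) :=
      NNReal.tendsto_coe.2 (Tendsto.finset_sup_nhds_apply hy)
    exact this.eventually_le_const (by linarith)
  rw [stepArea_eq F t y (M := M) (by linarith)]
  have h3 : Tendsto (fun n => ∫ s in (0 : ℝ)..M, stepHeight F (t' n) (y' n) s) l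
      (𝓝 (∫ s in (0 : ℝ)..M, stepHeight F t y s)) := by
    refine intervalIntegral.tendsto_integral_filter_of_dominated_convergence
      (fun _ => (F.sup y : ℝ≥0) + 1) (Eventually.of_forall fun n =>
        (stepHeight_antitone F _ _).measurable.aestronglyMeasurable) ?_
      intervalIntegrable_const ?_
    · filter_upwards [h2] with n hn
      refine ae_of_all _ fun s _ => ?_
      rw [Real.norm_of_nonneg (stepHeight_nonneg _ _ _ _)]
      exact (stepHeight_le_sup F _ _ s).trans hn
    · have hnot : ∀ᵐ s : ℝ, ∀ i ∈ F, s ≠ t i := by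
        refine (Finset.eventually_all F).2 fun i _ => ?_
        exact (measure_eq_zero_iff_ae_notMem.1 (measure_singleton (t i : ℝ))).mono
          fun s hs h => hs h
      filter_upwards [hnot] with s hs _
      refine NNReal.tendsto_coe.2 (Tendsto.finset_sup_nhds_apply fun i hi => ?_)
      have h4 : Tendsto (fun n => (t' n i : ℝ)) l (𝓝 (t i)) := NNReal.tendsto_coe.2 (ht i hi)
      rcases (hs i hi).lt_or_gt with h | h
      · rw [if_pos h]
        refine (hy i hi).congr' ?_
        filter_upwards [h4.eventually_const_lt h] with n hn
        rw [if_pos hn]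
      · rw [if_neg h.not_gt]
        refine tendsto_const_nhds.congr' ?_
        filter_upwards [h4.eventually_lt_const h] with n hn
        rw [if_neg hn.not_gt]
  refine h3.congr' ?_
  filter_upwards [h1] with n hn
  rw [stepArea_eq F _ _ hn]

/-- A continuous function of compact support that is positive exactly on the union of the
rectangles `[0,t_i) × [0,y_i)`, `i ∈ F`. -/
def tent : CompactlySupportedContinuousMap (ℝ≥0 × ℝ≥0) ℝ where
  toFun q := (F.sup fun i => min (t i - q.1) (y i - q.2) : ℝ≥0)
  continuous_toFun := NNReal.continuous_coe.comp
    (Continuous.finset_sup_apply fun i _ => by fun_prop)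
  hasCompactSupport' := by
    refine HasCompactSupport.intro ((isCompact_Icc (a := 0) (b := F.sup t)).prod
      (isCompact_Icc (a := 0) (b := F.sup y))) fun q hq => ?_
    rw [NNReal.coe_eq_zero, ← nonpos_iff_eq_zero, Finset.sup_le_iff]
    intro i hi
    by_contra! h
    refine hq ⟨⟨zero_le, ?_⟩, ⟨zero_le, ?_⟩⟩
    · exact (tsub_pos_iff_lt.1 (lt_min_iff.1 h).1).le.trans (Finset.le_sup hi)
    · exact (tsub_pos_iff_lt.1 (lt_min_iff.1 h).2).le.trans (Finset.le_sup hi)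

theorem tent_nonneg (q : ℝ≥0 × ℝ≥0) : 0 ≤ tent F t y q := NNReal.coe_nonneg _

theorem le_tent {i : ι} (hi : i ∈ F) (q : ℝ≥0 × ℝ≥0) :
    ((min (t i - q.1) (y i - q.2) : ℝ≥0) : ℝ) ≤ tent F t y q :=
  NNReal.coe_le_coe.2 (Finset.le_sup (f := fun i => min (t i - q.1) (y i - q.2)) hi)

theorem tent_eq_zero_iff (q : ℝ≥0 × ℝ≥0) : tent F t y q = 0 ↔ ∀ i ∈ F, q.1 < t i → y i ≤ q.2 := by
  change ((F.sup fun i => min (t i - q.1) (y i - q.2) : ℝ≥0) : ℝ) = 0 ↔ _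
  rw [NNReal.coe_eq_zero, ← nonpos_iff_eq_zero, Finset.sup_le_iff]
  refine forall₂_congr fun i _ => ?_
  rw [min_le_iff, nonpos_iff_eq_zero, nonpos_iff_eq_zero, tsub_eq_zero_iff_le,
    tsub_eq_zero_iff_le, ← not_lt, imp_iff_not_or]

end Staircase

/-! ## Convergence of void probabilities -/

section VoidProbabilities

namespace PointMeasure

theorem isFiniteMeasureOnCompacts {E : Type*} [TopologicalSpace E] [MeasurableSpace E]
    (m : PointMeasure E) : IsFiniteMeasureOnCompacts m.1 := ⟨fun _ hK => m.2.2 _ hK⟩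

variable {E : Type*} [TopologicalSpace E] [MeasurableSpace E]
  (f : CompactlySupportedContinuousMap E ℝ)

theorem continuous_integral :
    Continuous fun m : PointMeasure E => ∫ x, f x ∂m.1 :=
  continuous_iInf_dom (i := f) continuous_induced_dom

theorem integrable [OpensMeasurableSpace E] (m : PointMeasure E) :
    Integrable f m.1 :=
  have := m.isFiniteMeasureOnCompacts
  f.continuous.integrable_of_hasCompactSupport f.hasCompactSupport

theorem integral_eq_zero_iff [OpensMeasurableSpace E] (hf : ∀ x, 0 ≤ f x) (m : PointMeasure E) :
    ∫ x, f x ∂m.1 = 0 ↔ ∀ᵐ x ∂m.1, f x = 0 :=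
  integral_eq_zero_iff_of_nonneg hf (integrable f m)

end PointMeasure

theorem aemeasurable_integral {Ω : Type*} [MeasurableSpace Ω] {P : Measure Ω}
    {N : Ω → PointMeasure (ℝ≥0 × ℝ≥0)} (hN : AEMeasurable N P)
    (f : CompactlySupportedContinuousMap (ℝ≥0 × ℝ≥0) ℝ) :
    AEMeasurable (fun ω => ∫ x, f x ∂(N ω).1) P :=
  (PointMeasure.continuous_integral f).measurable.comp_aemeasurable hN

variable {Ω Ω₁ κ : Type*} [MeasurableSpace Ω] [MeasurableSpace Ω₁] {P : Measure Ω}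
  [IsProbabilityMeasure P] {P₁ : Measure Ω₁} [IsProbabilityMeasure P₁]
  {N : κ → Ω → PointMeasure (ℝ≥0 × ℝ≥0)} {N' : Ω₁ → PointMeasure (ℝ≥0 × ℝ≥0)}
  {l : Filter κ}

theorem integrable_exp_neg_integral {N : Ω → PointMeasure (ℝ≥0 × ℝ≥0)} (hN : AEMeasurable N P)
    {f : CompactlySupportedContinuousMap (ℝ≥0 × ℝ≥0) ℝ} (hf : ∀ x, 0 ≤ f x) {c : ℝ}
    (hc : 0 ≤ c) : Integrable (fun ω => Real.exp (-(c * ∫ x, f x ∂(N ω).1))) P := by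
  have := aemeasurable_integral hN f
  refine Integrable.of_bound (C := 1) (AEMeasurable.aestronglyMeasurable (by fun_prop))
    (ae_of_all _ fun ω => ?_)
  rw [Real.norm_of_nonneg (Real.exp_pos _).le, Real.exp_le_one_iff]
  have : 0 ≤ ∫ x, f x ∂(N ω).1 := integral_nonneg hf
  have := mul_nonneg hc this
  linarith

/-- Weak convergence of point processes entails convergence of Laplace functionals. -/
theorem tendsto_laplace (hconv : TendstoInDistribution N l N' (fun _ => P) P₁)
    {f : CompactlySupportedContinuousMap (ℝ≥0 × ℝ≥0) ℝ} (hf : ∀ x, 0 ≤ f x) {c : ℝ}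
    (hc : 0 ≤ c) :
    Tendsto (fun n => ∫ ω, Real.exp (-(c * ∫ x, f x ∂(N n ω).1)) ∂P) l
      (𝓝 (∫ ω, Real.exp (-(c * ∫ x, f x ∂(N' ω).1)) ∂P₁)) := by
  have hcont : Continuous fun m : PointMeasure (ℝ≥0 × ℝ≥0) =>
      Real.exp (-(c * max 0 (∫ x, f x ∂m.1))) := by
    have := PointMeasure.continuous_integral f
    fun_prop
  let g : BoundedContinuousFunction (PointMeasure (ℝ≥0 × ℝ≥0)) ℝ :=
    BoundedContinuousFunction.ofNormedAddCommGroup _ hcont 1 fun m => by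
      rw [Real.norm_of_nonneg (Real.exp_pos _).le, Real.exp_le_one_iff]
      have := mul_nonneg hc (le_max_left 0 (∫ x, f x ∂m.1))
      linarith
  have hg : ∀ m, g m = Real.exp (-(c * ∫ x, f x ∂m.1)) := fun m => by
    change Real.exp (-(c * max 0 (∫ x, f x ∂m.1))) = _
    rw [max_eq_right (integral_nonneg hf)]
  have h1 := (ProbabilityMeasure.tendsto_iff_forall_integral_tendsto.1 hconv.tendsto) g
  simp only [ProbabilityMeasure.coe_mk] at h1
  rw [integral_map hconv.aemeasurable_limit g.continuous.measurable.aestronglyMeasurable] at h1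
  simp_rw [integral_map (hconv.forall_aemeasurable _)
    g.continuous.measurable.aestronglyMeasurable] at h1
  simpa only [hg] using h1

theorem integral_le_measureReal_add {g : Ω → ℝ} (hg : Integrable g P)
    (h1 : ∀ ω, g ω ≤ 1) {c : ℝ} (hc : 0 ≤ c) : ∫ ω, g ω ∂P ≤ P.real {ω | c < g ω} + c := by
  have hA : NullMeasurableSet {ω | c < g ω} P :=
    nullMeasurableSet_lt aemeasurable_const hg.aemeasurable
  have h2 : ∫ ω, ({ω | c < g ω}.indicator (fun _ => (1 : ℝ)) ω + c) ∂P =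
      P.real {ω | c < g ω} + c := by
    rw [integral_add ((integrable_const _).indicator₀ hA) (integrable_const c),
      integral_indicator₀ hA]
    simp
  rw [← h2]
  refine integral_mono hg (((integrable_const _).indicator₀ hA).add (integrable_const c))
    fun ω => ?_
  by_cases h : c < g ω
  · have : ω ∈ {ω | c < g ω} := h
    simp only [indicator_of_mem this]
    linarith [h1 ω]
  · have : ω ∉ {ω | c < g ω} := h
    simp only [indicator_of_notMem this]
    linarith

/-- Probabilities of events that are squeezed between `{N_n(t,y) = 0}` and
`{N_n(t+ε,y+ε) < ε}`, in terms of tent functions, converge to the void probability. -/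
theorem tendsto_measureReal_of_tent {ι : Type*} (F : Finset ι) (t y : ι → ℝ≥0) {θ : ℝ}
    [l.IsCountablyGenerated]
    (hconv : TendstoInDistribution N l N' (fun _ => P) P₁)
    (hvoid : ∀ t y : ι → ℝ≥0, P₁.real {ω | ∫ x, tent F t y x ∂(N' ω).1 = 0} =
      Real.exp (-θ * stepArea F t y))
    {A : κ → Set Ω} (hA : ∀ n, ∀ᵐ ω ∂P, ω ∈ A n → ∫ x, tent F t y x ∂(N n ω).1 = 0)
    (hA' : ∀ n, ∀ ε : ℝ≥0, ∀ᵐ ω ∂P, ω ∉ A n →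
      ε ≤ ∫ x, tent F (fun i => t i + ε) (fun i => y i + ε) x ∂(N n ω).1) :
    Tendsto (fun n => P.real (A n)) l (𝓝 (Real.exp (-θ * stepArea F t y))) := by
  rw [tendsto_order]
  constructor
  · intro b hb
    -- Lower bound. Off `A n` the enlarged tent has integral at least `ε`, so there the Laplace
    -- integrand is at most `exp(-c ε)`. First `ε` is chosen by continuity of the area, then `c`
    -- with `exp(-c ε) < b' - b`.
    obtain ⟨b', hbb', hb'⟩ := exists_between hb
    have h1 : Tendsto (fun ε : ℝ≥0 => Real.exp (-θ *
        stepArea F (fun i => t i + ε) (fun i => y i + ε))) (𝓝[>] 0)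
        (𝓝 (Real.exp (-θ * stepArea F t y))) := by
      have hadd : ∀ a : ℝ≥0, Tendsto (fun ε : ℝ≥0 => a + ε) (𝓝[>] 0) (𝓝 a) := fun a => by
        have : Tendsto (fun ε : ℝ≥0 => a + ε) (𝓝 0) (𝓝 (a + 0)) :=
          (continuous_const.add continuous_id).tendsto 0
        rw [add_zero] at this
        exact this.mono_left nhdsWithin_le_nhds
      exact (Real.continuous_exp.tendsto _).comp ((tendsto_stepArea F t y
        (fun i _ => hadd (t i)) (fun i _ => hadd (y i))).const_mul (-θ))
    obtain ⟨ε, hε, hεpos⟩ := ((h1.eventually_const_lt hb').and self_mem_nhdsWithin).exists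
    have hε0 : (0 : ℝ) < ε := hεpos
    have h2 : Tendsto (fun c : ℝ => Real.exp (-(c * ε))) atTop (𝓝 0) :=
      Real.tendsto_exp_neg_atTop_nhds_zero.comp (tendsto_id.atTop_mul_const hε0)
    obtain ⟨c, hc, hc0⟩ := ((h2.eventually_lt_const (sub_pos.2 hbb')).and
      (eventually_ge_atTop 0)).exists
    set f := tent F (fun i => t i + ε) (fun i => y i + ε) with hf
    have hf0 : ∀ x, 0 ≤ f x := tent_nonneg _ _ _
    have h3 : b' < ∫ ω, Real.exp (-(c * ∫ x, f x ∂(N' ω).1)) ∂P₁ := by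
      refine hε.trans_le ?_
      rw [← hvoid]
      have := mul_meas_ge_le_integral_of_nonneg (ae_of_all _ fun ω => (Real.exp_pos _).le)
        (integrable_exp_neg_integral hconv.aemeasurable_limit hf0 hc0) 1
      rw [one_mul] at this
      refine le_trans (measureReal_mono fun ω hω => ?_) this
      have hω' : ∫ x, f x ∂(N' ω).1 = 0 := hω
      change 1 ≤ Real.exp (-(c * ∫ x, f x ∂(N' ω).1))
      simp [hω']
    filter_upwards [(tendsto_laplace hconv hf0 hc0).eventually_const_lt h3] with n hn
    have h4 := integral_le_measureReal_add
      (integrable_exp_neg_integral (hconv.forall_aemeasurable n) hf0 hc0) (fun ω => by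
        rw [Real.exp_le_one_iff]
        have h0 : 0 ≤ ∫ x, f x ∂(N n ω).1 := integral_nonneg hf0
        have := mul_nonneg hc0 h0
        linarith) (Real.exp_pos (-(c * ε))).le
    have h5 : P.real {ω | Real.exp (-(c * ε)) < Real.exp (-(c * ∫ x, f x ∂(N n ω).1))} ≤
        P.real (A n) := by
      refine ENNReal.toReal_mono (measure_ne_top _ _) (measure_mono_ae ?_)
      filter_upwards [hA' n ε] with ω hω hlt
      by_contra hn'
      have hlt' : Real.exp (-(c * ε)) < Real.exp (-(c * ∫ x, f x ∂(N n ω).1)) := hlt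
      rw [Real.exp_lt_exp] at hlt'
      have := mul_le_mul_of_nonneg_left (hω hn') hc0
      linarith
    linarith
  · intro b hb
    -- Upper bound. On `A n` the Laplace integrand is `1`, so `P(A n)` is at most the Laplace
    -- functional of `k f`; for the limit process this functional tends to the void probability as
    -- `k → ∞`.
    set f := tent F t y with hf
    have hf0 : ∀ x, 0 ≤ f x := tent_nonneg _ _ _
    have h1 : Tendsto (fun k : ℕ => ∫ ω, Real.exp (-((k : ℝ) * ∫ x, f x ∂(N' ω).1)) ∂P₁) atTop
        (𝓝 (Real.exp (-θ * stepArea F t y))) := by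
      have hm := aemeasurable_integral hconv.aemeasurable_limit f
      have hnull : NullMeasurableSet {ω | ∫ x, f x ∂(N' ω).1 = 0} P₁ :=
        nullMeasurableSet_eq_fun hm aemeasurable_const
      have h2 : Real.exp (-θ * stepArea F t y) =
          ∫ ω, {ω | ∫ x, f x ∂(N' ω).1 = 0}.indicator (fun _ => (1 : ℝ)) ω ∂P₁ := by
        rw [integral_indicator₀ hnull, ← hvoid]
        simp [hf]
      rw [h2]
      refine tendsto_integral_of_dominated_convergence (fun _ => 1)
        (fun k => (integrable_exp_neg_integral hconv.aemeasurable_limit hf0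
          k.cast_nonneg).aestronglyMeasurable) (integrable_const _) (fun k => ?_) ?_
      · refine ae_of_all _ fun ω => ?_
        rw [Real.norm_of_nonneg (Real.exp_pos _).le, Real.exp_le_one_iff]
        have h0 : 0 ≤ ∫ x, f x ∂(N' ω).1 := integral_nonneg hf0
        have := mul_nonneg (k.cast_nonneg (α := ℝ)) h0
        linarith
      · refine ae_of_all _ fun ω => ?_
        have h0 : 0 ≤ ∫ x, f x ∂(N' ω).1 := integral_nonneg hf0
        rcases h0.eq_or_lt with h | h
        · have hω : ω ∈ {ω | ∫ x, f x ∂(N' ω).1 = 0} := h.symm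
          rw [indicator_of_mem hω]
          simp only [← h]
          simp
        · have hω : ω ∉ {ω | ∫ x, f x ∂(N' ω).1 = 0} := h.ne'
          rw [indicator_of_notMem hω]
          exact Real.tendsto_exp_neg_atTop_nhds_zero.comp
            (tendsto_natCast_atTop_atTop.atTop_mul_const h)
    obtain ⟨k, hk⟩ := (h1.eventually_lt_const hb).exists
    filter_upwards [(tendsto_laplace hconv hf0 k.cast_nonneg).eventually_lt_const hk] with n hn
    refine lt_of_le_of_lt ?_ hn
    have := mul_meas_ge_le_integral_of_nonneg (ae_of_all _ fun ω => (Real.exp_pos _).le)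
      (integrable_exp_neg_integral (hconv.forall_aemeasurable n) hf0 k.cast_nonneg) 1
    rw [one_mul] at this
    refine le_trans (ENNReal.toReal_mono (measure_ne_top _ _) (measure_mono_ae ?_)) this
    filter_upwards [hA n] with ω hω hωA
    change 1 ≤ Real.exp (-((k : ℝ) * ∫ x, f x ∂(N n ω).1))
    simp [hω hωA]

end VoidProbabilities

/-! ## Void probabilities of Mori–Hsing processes -/

/-- With each point the region contains everything below it. A cluster over `(T, U)` has the heights
`U z` with `z ≥ 1`, and `z = 1` occurs, so it avoids the region exactly when `(T, U)` does. What
remains is the void probability of the Poisson points `(T, U)`. -/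
theorem IsMoriHsing.measureReal_void {Ω : Type*} [MeasurableSpace Ω] {P : Measure Ω} {θ : ℝ}
    (hθ : 0 < θ) {N : Ω → PointMeasure (ℝ≥0 × ℝ≥0)} (hN : IsMoriHsing θ N P) {ι : Type*}
    (F : Finset ι) (t y : ι → ℝ≥0) :
    P.real {ω | ∫ x, tent F t y x ∂(N ω).1 = 0} = Real.exp (-θ * stepArea F t y) := by
  obtain ⟨τ, U, γ, hτ, hτi, hU, hUi, -, hγ1, hτU, -, hNeq⟩ := hN
  have hcoe : Measurable fun (x : ℕ × ℕ → ℝ≥0) (p : ℕ × ℕ) => (x p : ℝ) := by fun_prop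
  have hind : IndepFun (fun ω p => (τ p ω : ℝ)) (fun ω p => (U p ω : ℝ)) P :=
    hτU.comp hcoe (hcoe.comp measurable_fst)
  have h1 := measure_forall_le_arrivalTime hθ hτ
    (hτi.comp (fun _ x => (x : ℝ)) fun _ => measurable_coe_nnreal_real) hU
    (hUi.comp (fun _ x => (x : ℝ)) fun _ => measurable_coe_nnreal_real) hind
    (stepHeight_antitone F t y) (stepHeight_nonneg F t y) (I := ⌈F.sup y⌉₊)
    (fun s => (stepHeight_le_sup F t y s).trans (by exact_mod_cast Nat.le_ceil _))
    (M := (F.sup t : ℝ≥0)) (fun s hs => stepHeight_eq_zero F t y hs)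
  rw [measureReal_def, ← ENNReal.toReal_ofReal (Real.exp_pos (-θ * stepArea F t y)).le]
  congr 1
  rw [stepArea, ← h1]
  refine measure_congr ?_
  filter_upwards [hNeq, ae_all_iff.2 hγ1] with ω hω hγω
  refine eq_iff_iff.2 (((N ω).integral_eq_zero_iff _ (tent_nonneg F t y)).trans ?_)
  have hm : ∀ p, Measurable fun z : Ici (1 : ℝ≥0) =>
      (∑ l ∈ Finset.range (p.2 + 1), τ (p.1, l) ω, U p ω * (z : ℝ≥0)) := fun p => by fun_prop
  have hms : MeasurableSet {x | tent F t y x = 0} :=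
    measurableSet_eq_fun (tent F t y).continuous.measurable measurable_const
  rw [hω, Measure.ae_sum_iff]
  refine forall_congr' fun p => ?_
  rw [ae_map_iff (hm p).aemeasurable hms]
  have harr : arrivalTime (fun p => (τ p ω : ℝ)) p =
      ((∑ l ∈ Finset.range (p.2 + 1), τ (p.1, l) ω : ℝ≥0) : ℝ) := by
    simp [arrivalTime]
  simp only [tent_eq_zero_iff]
  change _ ↔ stepHeight F t y (arrivalTime (fun p => (τ p ω : ℝ)) p) ≤ (U p ω : ℝ)
  rw [harr, stepHeight_le_iff]
  simp only [NNReal.coe_lt_coe]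
  constructor
  · intro h i hi hlt
    by_contra hc
    refine hγω p (measure_mono_null ?_ h)
    rintro _ rfl
    simp only [mem_compl_iff, mem_ofPred_eq, mul_one]
    exact fun h' => hc (h' i hi hlt)
  · refine fun h => ae_of_all _ fun z i hi hlt => (h i hi hlt).trans ?_
    exact le_mul_of_one_le_right zero_le z.2

/-! ## Void events of the empirical point measures -/

section TimeMark

variable {ι : Type*} {F : Finset ι} {t y : ι → ℝ≥0} {n : ℕ+} {v : ℕ → ℝ≥0}

theorem integral_tent_timeMark_eq_zero
    (h : ∀ i ∈ F, ∀ j : ℕ, (j : ℝ≥0) / (n : ℕ) ≤ t i → y i ≤ v j) :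
    ∫ x, tent F t y x ∂(timeMarkPointMeasure n v).1 = 0 := by
  rw [PointMeasure.integral_eq_zero_iff _ (tent_nonneg F t y)]
  change ∀ᵐ x ∂(Measure.sum fun j : ℕ => Measure.dirac ((j : ℝ≥0) / (n : ℕ), v j)), _
  rw [Measure.ae_sum_iff]
  intro j
  have hms : MeasurableSet {x | tent F t y x = 0} :=
    measurableSet_eq_fun (tent F t y).continuous.measurable measurable_const
  rw [ae_dirac_iff hms, tent_eq_zero_iff]
  exact fun i hi hlt => h i hi j hlt.le

/-- A single point with time at most `t i` and mark below `y i` lies at depth at least `ε` in the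
enlarged rectangle. The enlargement also covers points with time exactly `t i`, where `tent F t y`
may vanish. -/
theorem le_integral_tent_timeMark (ε : ℝ≥0)
    (h : ¬∀ i ∈ F, ∀ j : ℕ, (j : ℝ≥0) / (n : ℕ) ≤ t i → y i ≤ v j) :
    ε ≤ ∫ x, tent F (fun i => t i + ε) (fun i => y i + ε) x ∂(timeMarkPointMeasure n v).1 := by
  push Not at h
  obtain ⟨i, hi, j, h1, h2⟩ := h
  set f := tent F (fun i => t i + ε) (fun i => y i + ε)
  have h3 : (Measure.dirac ((j : ℝ≥0) / (n : ℕ), v j)) ≤ (timeMarkPointMeasure n v).1 :=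
    Measure.le_sum (fun j : ℕ => Measure.dirac ((j : ℝ≥0) / (n : ℕ), v j)) j
  have h4 := integral_mono_measure h3 (ae_of_all _ (tent_nonneg F _ _))
    (PointMeasure.integrable f _)
  rw [integral_dirac] at h4
  refine le_trans (le_trans (NNReal.coe_le_coe.2 ?_) (le_tent F _ _ hi _)) h4
  exact le_min (le_tsub_of_add_le_left (by gcongr)) (le_tsub_of_add_le_left (by gcongr))

end TimeMark

/-! ## The finite-dimensional laws of `Z_H` -/

theorem stepHeight_congr {ι ι' : Type*} {F : Finset ι} {t y : ι → ℝ≥0} {F' : Finset ι'}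
    {t' y' : ι' → ℝ≥0} {s : ℝ}
    (h : ∀ v, (∀ i ∈ F, s < t i → y i ≤ v) ↔ ∀ i ∈ F', s < t' i → y' i ≤ v) :
    stepHeight F t y s = stepHeight F' t' y' s := by
  refine congrArg NNReal.toReal (eq_of_forall_ge_iff fun v => ?_)
  rw [← NNReal.coe_le_coe, ← NNReal.coe_le_coe]
  exact (stepHeight_le_iff F t y).trans ((h v).trans (stepHeight_le_iff F' t' y').symm)

/-- Between consecutive times the height of the union of rectangles is the constant `max_{j ≥ i}
y_j`, so the exponents in the product add up to `-θ` times the area. -/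
theorem prod_survivalH_eq (θ : ℝ) {k : ℕ} {t : Fin k → ℝ≥0} (ht : StrictMono t)
    (y : Fin k → ℝ≥0) :
    ∏ i, survivalH θ ((Finset.Ici i).sup y) ^
        ((t i : ℝ) - ((Fin.cons 0 t : Fin (k + 1) → ℝ≥0) i.castSucc : ℝ)) =
      Real.exp (-θ * stepArea Finset.univ t y) := by
  set b : Fin (k + 1) → ℝ≥0 := Fin.cons 0 t with hb
  have hbmono : Monotone b := by
    refine Fin.monotone_iff_le_succ.2 fun i => ?_
    rw [hb, Fin.cons_succ]
    rcases i with ⟨i, hi⟩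
    cases i with
    | zero => exact zero_le
    | succ i =>
      have : (⟨i + 1, hi⟩ : Fin k).castSucc = Fin.succ ⟨i, by omega⟩ := rfl
      rw [this, Fin.cons_succ]
      exact (ht (show (⟨i, _⟩ : Fin k) < ⟨i + 1, hi⟩ from Nat.lt_succ_self i)).le
  -- The partition points `0, t_1, …, t_k` as a sequence; the value `0` past index `k` is never
  -- reached.
  let a : ℕ → ℝ := fun m => if h : m < k + 1 then (b ⟨m, h⟩ : ℝ) else 0
  have ha : ∀ i : Fin k, a i = b i.castSucc := fun i => by
    simp only [a]
    rw [dif_pos (by omega)]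
    rfl
  have ha' : ∀ i : Fin k, a (i + 1) = t i := fun i => by
    simp only [a]
    rw [dif_pos (by omega), hb]
    rfl
  have hint : ∀ c d, IntervalIntegrable (stepHeight Finset.univ t y) volume c d := fun c d =>
    (stepHeight_antitone _ t y).intervalIntegrable
  have hpiece : ∀ i : Fin k, ∫ s in a i..a (i + 1), stepHeight Finset.univ t y s =
      ((Finset.Ici i).sup y : ℝ≥0) * ((t i : ℝ) - b i.castSucc) := fun i => by
    rw [ha, ha', intervalIntegral.integral_congr_Ioo_of_le
      (g := fun _ => (((Finset.Ici i).sup y : ℝ≥0) : ℝ)), intervalIntegral.integral_const,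
      smul_eq_mul, mul_comm]
    · exact NNReal.coe_le_coe.2 (hbmono (Fin.castSucc_le_succ i))
    · intro s hs
      refine congrArg NNReal.toReal (eq_of_forall_ge_iff fun v => ?_)
      rw [Finset.sup_le_iff, Finset.sup_le_iff]
      refine forall_congr' fun j => ?_
      have hj : s < t j ↔ i ≤ j := by
        constructor
        · intro h
          by_contra! hji
          have h1 : b j.succ ≤ b i.castSucc := hbmono (Fin.succ_le_castSucc_iff.2 hji)
          have h2 : ((b j.succ : ℝ≥0) : ℝ) ≤ b i.castSucc := NNReal.coe_le_coe.2 h1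
          rw [hb, Fin.cons_succ] at h2
          exact absurd (h.trans_le h2) hs.1.not_gt
        · exact fun h => hs.2.trans_le (NNReal.coe_le_coe.2 (ht.monotone h))
      by_cases h : i ≤ j
      · simp [hj, h]
      · simp [hj, h]
  have hsum := intervalIntegral.sum_integral_adjacent_intervals (n := k) (a := a)
    (f := stepHeight Finset.univ t y) (μ := volume) fun _ _ => hint _ _
  rw [Finset.sum_range] at hsum
  have h0 : a 0 = 0 := by simp [a, hb]
  have hk : ((Finset.univ.sup t : ℝ≥0) : ℝ) ≤ a k := by
    have : a k = b (Fin.last k) := by simp only [a]; rw [dif_pos (by omega)]; rfl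
    rw [this]
    refine NNReal.coe_le_coe.2 (Finset.sup_le fun i _ => ?_)
    exact (Fin.cons_succ (α := fun _ => ℝ≥0) 0 t i).symm.le.trans (hbmono (Fin.le_last i.succ))
  rw [stepArea_eq _ t y hk, ← h0, ← hsum, Finset.mul_sum, Real.exp_sum]
  refine Finset.prod_congr rfl fun i _ => ?_
  rw [hpiece, survivalH, ← Real.exp_mul, mul_assoc]

section ProcessZH

variable {Ω : Type*} [MeasurableSpace Ω] {P : Measure Ω} {θ : ℝ}
  {Z : Ω → SkorokhodSpace}

/-- Unordered or repeated times reduce to the defining formula: list the distinct times increasingly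
and keep the largest threshold at each. Neither the event nor the union of rectangles changes. -/
theorem IsProcessZH.measureReal_forall_le (hZ : IsProcessZH θ Z P) {ι : Type*} (F : Finset ι)
    (t y : ι → ℝ≥0) :
    P.real {ω | ∀ i ∈ F, (y i : ℝ≥0∞) ≤ (Z ω).1 (t i)} = Real.exp (-θ * stepArea F t y) := by
  classical
  set S := F.image t with hS
  set e := S.orderEmbOfFin rfl with he
  have hmem : ∀ i ∈ F, ∃ m, e m = t i := fun i hi => by
    have : t i ∈ Set.range e := by
      rw [he, Finset.range_orderEmbOfFin]
      exact Finset.mem_image_of_mem _ hi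
    exact this
  let z : Fin S.card → ℝ≥0 := fun m => (F.filter fun i => t i = e m).sup y
  have h1 := hZ.2 S.card e z e.strictMono
  rw [prod_survivalH_eq θ e.strictMono z] at h1
  rw [stepArea_congr (F := Finset.univ) (t := e) (y := z) (F' := F) (t' := t) (y' := y)] at h1
  · rw [← h1]
    congr 1
    ext ω
    refine ⟨fun h m => ?_, fun h i hi => ?_⟩
    · rw [ENNReal.coe_finset_sup, Finset.sup_le_iff]
      intro i hi
      rw [Finset.mem_filter] at hi
      rw [← hi.2]
      exact h i hi.1
    · obtain ⟨m, hm⟩ := hmem i hi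
      rw [← hm]
      refine le_trans (ENNReal.coe_le_coe.2 ?_) (h m)
      exact Finset.le_sup (Finset.mem_filter.2 ⟨hi, hm.symm⟩)
  · refine fun s _ => stepHeight_congr fun v => ⟨fun h i hi hs => ?_, fun h m _ hs => ?_⟩
    · obtain ⟨m, hm⟩ := hmem i hi
      rw [← hm] at hs
      exact (Finset.le_sup (Finset.mem_filter.2 ⟨hi, hm.symm⟩)).trans (h m (Finset.mem_univ _) hs)
    · refine Finset.sup_le fun i hi => ?_
      rw [Finset.mem_filter] at hi
      rw [← hi.2] at hs
      exact h i hi.1 hs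

theorem antitone_of_forall_rat {g : ℝ≥0 → ℝ≥0∞} (hg : ∀ t, ContinuousWithinAt g (Ici t) t)
    (h : ∀ a b : ℚ, a ≤ b → g (Real.toNNReal b) ≤ g (Real.toNNReal a)) : Antitone g := by
  have key : ∀ (t t' : ℝ≥0) (p : ℝ≥0 → Prop), t < t' → (∀ᶠ s in 𝓝[≥] t, p s) →
      ∃ q : ℚ, t < Real.toNNReal q ∧ Real.toNNReal q < t' ∧ p (Real.toNNReal q) := by
    intro t t' p htt' hp
    obtain ⟨w, hw, hwp⟩ := (mem_nhdsGE_iff_exists_Ico_subset' htt').1 hp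
    obtain ⟨q, -, h1, h2⟩ := (NNReal.lt_iff_exists_rat_btwn t (min w t')).1 (lt_min hw htt')
    exact ⟨q, h1, h2.trans_le (min_le_right _ _), hwp ⟨h1.le, h2.trans_le (min_le_left _ _)⟩⟩
  intro a b hab
  rcases hab.eq_or_lt with rfl | hab
  · exact le_rfl
  by_contra! hlt
  obtain ⟨c, hc1, hc2⟩ := exists_between hlt
  obtain ⟨q, hq1, hq2, hq3⟩ := key a b _ hab ((hg a).eventually_lt_const hc1)
  obtain ⟨r, hr1, -, hr3⟩ := key b (b + 1) _ (lt_add_one b) ((hg b).eventually_const_lt hc2)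
  have hqr : q ≤ r := by
    by_contra! hrq
    have : Real.toNNReal r ≤ Real.toNNReal q := Real.toNNReal_le_toNNReal (by exact_mod_cast hrq.le)
    exact absurd (hr1.trans_le this) hq2.not_gt
  exact absurd (hr3.trans_le (h q r hqr)) hq3.not_gt

/-- For `a ≤ b` the rectangle `[0,a) × [0,c)` lies in `[0,b) × [0,c)`, so adding the condition `c ≤
Z a` to `c ≤ Z b` does not change the probability. Hence the second condition almost surely implies
the first; rationals and right continuity give all times and levels at once. -/
theorem IsProcessZH.ae_antitone [IsProbabilityMeasure P] (hZ : IsProcessZH θ Z P) : ∀ᵐ ω ∂P, Antitone (Z ω).1 := by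
  have h1 : ∀ a b c : ℝ≥0, a ≤ b → ∀ᵐ ω ∂P, (c : ℝ≥0∞) ≤ (Z ω).1 b → (c : ℝ≥0∞) ≤ (Z ω).1 a := by
    intro a b c hab
    have h2 := hZ.measureReal_forall_le {a, b} id fun _ => c
    have h3 := hZ.measureReal_forall_le {b} id fun _ => c
    rw [stepArea_congr (F' := {b}) (t' := id) (y' := fun _ => c), ← h3] at h2
    · simp only [Finset.mem_insert, Finset.mem_singleton, forall_eq_or_imp, forall_eq, id_eq]
        at h2
      have h4 := ae_eq_of_subset_of_measure_ge (fun ω hω => hω.2)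
        ((measureReal_eq_measureReal_iff).1 h2).ge
        ((measurableSet_le measurable_const (hZ.1 a)).inter
          (measurableSet_le measurable_const (hZ.1 b))).nullMeasurableSet (measure_ne_top _ _)
      filter_upwards [h4] with ω hω hb
      exact (hω.mpr hb).1
    · refine fun s _ => stepHeight_congr fun v => ?_
      simp only [Finset.mem_insert, Finset.mem_singleton, forall_eq_or_imp, forall_eq, id_eq]
      refine ⟨fun h => h.2, fun h => ⟨fun hs => h (hs.trans_le (NNReal.coe_le_coe.2 hab)), h⟩⟩
  have h2 : ∀ᵐ ω ∂P, ∀ a b c : ℚ, a ≤ b → (Real.toNNReal c : ℝ≥0∞) ≤ (Z ω).1 (Real.toNNReal b) →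
      (Real.toNNReal c : ℝ≥0∞) ≤ (Z ω).1 (Real.toNNReal a) := by
    simp only [ae_all_iff]
    exact fun a b c hab => h1 _ _ _ (Real.toNNReal_le_toNNReal (by exact_mod_cast hab))
  filter_upwards [h2] with ω hω
  refine antitone_of_forall_rat (fun t => ((Z ω).2 t).1) fun a b hab => ?_
  by_contra! hlt
  obtain ⟨c, -, hc1, hc2⟩ := ENNReal.lt_iff_exists_rat_btwn.1 hlt
  exact absurd (hω a b c hab hc2.le) hc1.not_ge

/-- Since `P(Z n ≥ c) = exp(-θ c n)` tends to `0`, almost surely the path falls below each level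
`1/(m+1)`, and these levels come below any `y > 0`. -/
theorem IsProcessZH.ae_pathInv_ne_top [IsProbabilityMeasure P] (hθ : 0 < θ) (hZ : IsProcessZH θ Z P) :
    ∀ᵐ ω ∂P, ∀ y : ℝ≥0, 0 < y → pathInv (Z ω).1 y ≠ ∞ := by
  have h1 : ∀ m : ℕ, ∀ᵐ ω ∂P, ∃ n : ℕ, (Z ω).1 n < ((1 / (m + 1) : ℝ≥0) : ℝ≥0∞) := by
    intro m
    set c : ℝ≥0 := 1 / (m + 1) with hc
    have hc0 : 0 < c := by positivity
    have h2 : ∀ n : ℕ, P.real {ω | (c : ℝ≥0∞) ≤ (Z ω).1 n} = Real.exp (-(θ * c * n)) := by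
      intro n
      have h3 := hZ.2 1 (fun _ => n) (fun _ => c) (Subsingleton.strictMono _)
      simp only [forall_const, Finset.univ_unique, Finset.prod_singleton] at h3
      rw [h3, survivalH, ← Real.exp_mul]
      simp
    have h4 : Tendsto (fun n : ℕ => Real.exp (-(θ * c * n))) atTop (𝓝 0) :=
      Real.tendsto_exp_neg_atTop_nhds_zero.comp
        (tendsto_natCast_atTop_atTop.const_mul_atTop (by positivity))
    rw [ae_iff]
    push Not
    rw [← measureReal_eq_zero_iff]
    refine le_antisymm (ge_of_tendsto' h4 fun n => ?_) measureReal_nonneg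
    rw [← h2 n]
    exact measureReal_mono fun ω hω => hω n
  filter_upwards [ae_all_iff.2 h1] with ω hω y hy
  obtain ⟨m, hm⟩ := exists_nat_one_div_lt hy
  obtain ⟨n, hn⟩ := hω m
  refine ((iInf₂_le (n : ℝ≥0) (hn.trans ?_)).trans_lt ENNReal.coe_lt_top).ne
  exact ENNReal.coe_lt_coe.2 hm

end ProcessZH

/-! ## Laws of path inverses -/

theorem pathInvPath_antitone (Z : ℝ≥0 → ℝ≥0∞) : Antitone (pathInvPath Z).1 :=
  (pathInv_antitone Z).rightLim

/-- The right limit at `q` of a nonincreasing function is its supremum over `y > q`. This expresses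
the inverse through events `y ≤ Z t`, whose probabilities are known. -/
theorem lt_pathInvPath_iff {Z : ℝ≥0 → ℝ≥0∞} (hZ : Antitone Z) {c : ℝ≥0∞} {q : ℝ≥0} :
    c < (pathInvPath Z).1 q ↔
      ∃ t y : ℝ≥0, c < t ∧ q < y ∧ (y : ℝ≥0∞) ≤ Z t := by
  have h1 : (pathInvPath Z).1 q = sSup (pathInv Z '' Ioi q) :=
    (pathInv_antitone Z).dual_right.rightLim_eq_sInf
  rw [h1, lt_sSup_iff]
  constructor
  · rintro ⟨_, ⟨y, hy, rfl⟩, h⟩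
    obtain ⟨t, h2, h3⟩ := ENNReal.lt_iff_exists_nnreal_btwn.1 h
    refine ⟨t, y, h2, hy, ?_⟩
    by_contra! h4
    exact absurd (iInf₂_le (f := fun (t : ℝ≥0) (_ : Z t < y) => (t : ℝ≥0∞)) t h4) h3.not_ge
  · rintro ⟨t, y, h2, hy, h3⟩
    refine ⟨_, mem_image_of_mem _ hy, h2.trans_le (le_iInf₂ fun s hs => ?_)⟩
    by_contra! hst
    exact absurd (h3.trans (hZ (ENNReal.coe_lt_coe.1 hst).le)) hs.not_ge

theorem lt_pathInvPath_iff_rat {Z : ℝ≥0 → ℝ≥0∞} (hZ : Antitone Z) {c : ℝ≥0∞} {q : ℝ≥0} :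
    c < (pathInvPath Z).1 q ↔ ∃ a b : ℚ, c < (Real.toNNReal a : ℝ≥0∞) ∧ q < Real.toNNReal b ∧
      (Real.toNNReal b : ℝ≥0∞) ≤ Z (Real.toNNReal a) := by
  rw [lt_pathInvPath_iff hZ]
  constructor
  · rintro ⟨t, y, h1, h2, h3⟩
    obtain ⟨a, -, ha1, ha2⟩ := ENNReal.lt_iff_exists_rat_btwn.1 h1
    obtain ⟨b, -, hb1, hb2⟩ := (NNReal.lt_iff_exists_rat_btwn q y).1 h2
    exact ⟨a, b, ha1, hb1, (ENNReal.coe_le_coe.2 hb2.le).trans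
      (h3.trans (hZ (ENNReal.coe_lt_coe.1 ha2).le))⟩
  · rintro ⟨a, b, h⟩
    exact ⟨_, _, h⟩

section Laws

variable {Ω κ ι : Type*} [MeasurableSpace Ω] {P : Measure Ω}

theorem aemeasurable_pathInvPath {Z : Ω → ℝ≥0 → ℝ≥0∞} (hanti : ∀ᵐ ω ∂P, Antitone (Z ω))
    (hZ : ∀ t y : ℝ≥0, NullMeasurableSet {ω | (y : ℝ≥0∞) ≤ Z ω t} P) (q : ℝ≥0) :
    AEMeasurable (fun ω => (pathInvPath (Z ω)).1 q) P := by
  refine NullMeasurable.aemeasurable (?_ : @Measurable (NullMeasurableSpace Ω P) _ _ _ _)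
  refine measurable_of_Ioi (δ := NullMeasurableSpace Ω P) fun c => ?_
  change NullMeasurableSet {ω | c < (pathInvPath (Z ω)).1 q} P
  have h : NullMeasurableSet {ω | ∃ a b : ℚ, c < (Real.toNNReal a : ℝ≥0∞) ∧
      q < Real.toNNReal b ∧ (Real.toNNReal b : ℝ≥0∞) ≤ Z ω (Real.toNNReal a)} P := by
    simp only [ofPred_exists]
    refine .iUnion fun a => .iUnion fun b => ?_
    exact (NullMeasurableSet.const _).inter ((NullMeasurableSet.const _).inter (hZ _ _))
  refine h.congr ?_
  filter_upwards [hanti] with ω hω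
  exact eq_iff_iff.2 (lt_pathInvPath_iff_rat hω).symm

/-- If the finite-dimensional survival functions of nonincreasing processes converge, then so do
the probabilities that their path inverses lie in upper sets. -/
theorem tendsto_measureReal_pathInvPath [IsProbabilityMeasure P] {l : Filter κ}
    {Z : κ → Ω → ℝ≥0 → ℝ≥0∞} {θ : ℝ} (hanti : ∀ n, ∀ᵐ ω ∂P, Antitone (Z n ω))
    (hlim : ∀ (F : Finset ι) (t y : ι → ℝ≥0),
      Tendsto (fun n => P.real {ω | ∀ i ∈ F, (y i : ℝ≥0∞) ≤ Z n ω (t i)}) l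
        (𝓝 (Real.exp (-θ * stepArea F t y))))
    {F : Finset ι} {U : ι → Set ℝ≥0∞} (hU : ∀ i ∈ F, IsUpperSet (U i))
    (hfin : ∀ i ∈ F, ∃ c : ℝ≥0, (c : ℝ≥0∞) ∈ U i) (q : ι → ℝ≥0) :
    Tendsto (fun n => P.real {ω | ∀ i ∈ F, (pathInvPath (Z n ω)).1 (q i) ∈ U i}) l
      (𝓝 (Real.exp (-θ * stepArea F (fun i => (sInf (U i)).toNNReal) q))) := by
  classical
  set c : ι → ℝ≥0 := fun i => (sInf (U i)).toNNReal with hc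
  have hcU : ∀ i ∈ F, (c i : ℝ≥0∞) = sInf (U i) := fun i hi => by
    obtain ⟨d, hd⟩ := hfin i hi
    exact ENNReal.coe_toNNReal ((sInf_le hd).trans_lt ENNReal.coe_lt_top).ne
  have hcont : ∀ {t' y' : ℝ≥0 → ι → ℝ≥0}, (∀ i, Continuous fun ε => t' ε i) →
      (∀ i, Continuous fun ε => y' ε i) → t' 0 = c → y' 0 = q →
      Tendsto (fun ε => Real.exp (-θ * stepArea F (t' ε) (y' ε))) (𝓝[>] 0)
        (𝓝 (Real.exp (-θ * stepArea F c q))) := by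
    intro t' y' ht hy ht0 hy0
    refine (Real.continuous_exp.tendsto _).comp ((tendsto_stepArea F c q (fun i _ => ?_)
      fun i _ => ?_).const_mul (-θ))
    · exact congrFun ht0 i ▸ ((ht i).tendsto 0).mono_left nhdsWithin_le_nhds
    · exact congrFun hy0 i ▸ ((hy i).tendsto 0).mono_left nhdsWithin_le_nhds
  rw [tendsto_order]
  constructor
  · intro b hb
    -- Lower bound: `Z(c_i + ε) ≥ q_i + ε` forces the inverse at `q_i` to exceed `c_i = sInf (U i)`,
    -- hence to lie in the upper set `U i`.
    obtain ⟨ε, hε, hε0⟩ := (((hcont (t' := fun ε i => c i + ε) (y' := fun ε i => q i + ε)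
      (fun i => by fun_prop) (fun i => by fun_prop) (by simp) (by simp)).eventually_const_lt
      hb).and self_mem_nhdsWithin).exists
    filter_upwards [(hlim F _ _).eventually_const_lt hε] with n hn
    refine hn.trans_le (ENNReal.toReal_mono (measure_ne_top _ _) (measure_mono_ae ?_))
    filter_upwards [hanti n] with ω hω h i hi
    have h1 : (c i : ℝ≥0∞) < (pathInvPath (Z n ω)).1 (q i) :=
      (lt_pathInvPath_iff hω).2 ⟨_, _, ENNReal.coe_lt_coe.2 (lt_add_of_pos_right _ hε0),
        lt_add_of_pos_right _ hε0, h i hi⟩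
    rw [hcU i hi, sInf_lt_iff] at h1
    obtain ⟨d, hd, hlt⟩ := h1
    exact hU i hi hlt.le hd
  · intro b hb
    -- Upper bound: membership in `U i` gives an inverse of at least `c_i`, hence `Z(c_i - ε) ≥ q_i`
    -- if `c_i > ε`. Indices with `c_i ≤ ε` give no such inequality, but with truncated subtraction
    -- their rectangles are empty and can be dropped.
    obtain ⟨ε, hε, hε0⟩ := (((hcont (t' := fun ε i => c i - ε) (y' := fun _ i => q i)
      (fun i => by fun_prop) (fun i => by fun_prop) (by simp) rfl).eventually_lt_const
      hb).and self_mem_nhdsWithin).exists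
    rw [stepArea_congr (F' := F.filter fun i => ε < c i) (t' := fun i => c i - ε) (y' := q)] at hε
    · filter_upwards [(hlim _ _ _).eventually_lt_const hε] with n hn
      refine lt_of_le_of_lt (ENNReal.toReal_mono (measure_ne_top _ _) (measure_mono_ae ?_)) hn
      filter_upwards [hanti n] with ω hω h i hi
      rw [Finset.mem_filter] at hi
      have h1 : ((c i - ε : ℝ≥0) : ℝ≥0∞) < (pathInvPath (Z n ω)).1 (q i) := by
        refine lt_of_lt_of_le (ENNReal.coe_lt_coe.2 (tsub_lt_self (pos_of_gt hi.2) hε0)) ?_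
        rw [hcU i hi.1]
        exact sInf_le (h i hi.1)
      obtain ⟨t, y, h2, h3, h4⟩ := (lt_pathInvPath_iff hω).1 h1
      exact (ENNReal.coe_le_coe.2 h3.le).trans (h4.trans (hω (ENNReal.coe_lt_coe.1 h2).le))
    · refine fun s hs => stepHeight_congr fun v => ?_
      refine ⟨fun h i hi => h i (Finset.mem_filter.1 hi).1, fun h i hi hlt => ?_⟩
      refine h i (Finset.mem_filter.2 ⟨hi, ?_⟩) hlt
      exact tsub_pos_iff_lt.1 (NNReal.coe_pos.1 (hs.trans_lt hlt))

end Laws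

/-! ## The empirical process -/

section Empirical

variable {Ω : Type*} {u : ℕ+ → ℝ≥0 → EReal} {X : ℕ → Ω → EReal} {n : ℕ+}

theorem le_invFun_iff (hu : StrictAnti (u n)) {w : EReal} (hw : w ∈ range (u n)) {y : ℝ≥0} :
    y ≤ Function.invFun (u n) w ↔ w ≤ u n y := by
  rw [← hu.le_iff_ge, Function.invFun_eq hw]

theorem partialMax_mem_range {ω : Ω} (hω : ∀ j, X j ω ∈ range (u n)) (k : ℕ) :
    partialMax X (k + 1) ω ∈ range (u n) := by
  obtain ⟨j, -, hj⟩ := Finset.exists_mem_eq_sup (Finset.range (k + 1)) ⟨0, by simp⟩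
    fun j => X j ω
  exact (show partialMax X (k + 1) ω = X j ω from hj) ▸ hω j

theorem le_empiricalZ_iff_partialMax (hu : StrictAnti (u n)) {ω : Ω}
    (hω : ∀ j, X j ω ∈ range (u n)) {t y : ℝ≥0} :
    (y : ℝ≥0∞) ≤ empiricalZ u X n ω t ↔
      partialMax X (⌊((n : ℕ) : ℝ≥0) * t⌋₊ + 1) ω ≤ u n y := by
  rw [empiricalZ, ENNReal.coe_le_coe, le_invFun_iff hu (partialMax_mem_range hω _)]

/-- As `u n` reverses order, the largest `X j` has the smallest mark: `Z_n(t)` is the least mark up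
to time `t`, and `Z_n(t) ≥ y` says that `N_n` has no point in `[0,t] × [0,y)`. -/
theorem le_empiricalZ_iff (hu : StrictAnti (u n)) {ω : Ω} (hω : ∀ j, X j ω ∈ range (u n))
    {t y : ℝ≥0} : (y : ℝ≥0∞) ≤ empiricalZ u X n ω t ↔
      ∀ j : ℕ, (j : ℝ≥0) / (n : ℕ) ≤ t → y ≤ Function.invFun (u n) (X j ω) := by
  rw [le_empiricalZ_iff_partialMax hu hω, partialMax, Finset.sup_le_iff]
  refine forall_congr' fun j => ?_
  have hn : (0 : ℝ≥0) < ((n : ℕ) : ℝ≥0) := by exact_mod_cast n.pos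
  rw [le_invFun_iff hu (hω j), Finset.mem_range, Nat.lt_succ_iff, Nat.le_floor_iff zero_le,
    div_le_iff₀ hn, mul_comm t]

theorem antitone_empiricalZ (hu : StrictAnti (u n)) {ω : Ω} (hω : ∀ j, X j ω ∈ range (u n)) :
    Antitone (empiricalZ u X n ω) := fun _ _ hab =>
  (le_empiricalZ_iff hu hω).2 fun j hj => (le_empiricalZ_iff hu hω).1 le_rfl j (hj.trans hab)

variable [MeasurableSpace Ω] {P : Measure Ω}

theorem nullMeasurableSet_le_empiricalZ (hX : ∀ j, Measurable (X j)) (hu : StrictAnti (u n))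
    (hrange : ∀ᵐ ω ∂P, ∀ j, X j ω ∈ range (u n)) (t y : ℝ≥0) :
    NullMeasurableSet {ω | (y : ℝ≥0∞) ≤ empiricalZ u X n ω t} P := by
  have hm : MeasurableSet {ω | partialMax X (⌊((n : ℕ) : ℝ≥0) * t⌋₊ + 1) ω ≤ u n y} := by
    simp only [partialMax, Finset.sup_le_iff, ofPred_forall]
    exact .iInter fun j => .iInter fun _ => measurableSet_le (hX j) measurable_const
  refine hm.nullMeasurableSet.congr ?_
  filter_upwards [hrange] with ω hω
  exact eq_iff_iff.2 (le_empiricalZ_iff_partialMax hu hω).symm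

end Empirical

/-! ### The main theorem -/

theorem mainTheorem8
    {Ω Ω₁ Ω₂ : Type*} [MeasurableSpace Ω] [MeasurableSpace Ω₁] [MeasurableSpace Ω₂]
    (P : Measure Ω) [IsProbabilityMeasure P]
    (P₁ : Measure Ω₁) [IsProbabilityMeasure P₁]
    (P₂ : Measure Ω₂) [IsProbabilityMeasure P₂]
    -- a stationary process `X_0, X_1, …`
    (X : ℕ → Ω → EReal) (hX : ∀ j, Measurable (X j))
    (hstat : IdentDistrib (fun ω j => X j ω) (fun ω j => X (j + 1) ω) P P)
    -- the level functions `u_n`, continuous and strictly decreasing, with the normalisation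
    -- `n P(X_0 > u_n(τ)) → τ`; their inverses are defined on the values of the process
    (u : ℕ+ → ℝ≥0 → EReal) (hucont : ∀ n, Continuous (u n)) (huanti : ∀ n, StrictAnti (u n))
    (hunorm : ∀ τ : ℝ≥0, 0 < τ →
      Tendsto (fun n : ℕ+ => ((n : ℕ) : ℝ) * P.real {ω | u n τ < X 0 ω}) atTop (𝓝 (τ : ℝ)))
    (hurange : ∀ (n : ℕ+) (j : ℕ), ∀ᵐ ω ∂P, X j ω ∈ range (u n))
    -- the limit of Mori–Hsing type and the process `Z_H`
    (θ : ℝ) (hθ : θ ∈ Ioc (0 : ℝ) 1)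
    (Ntilde : Ω₁ → PointMeasure (ℝ≥0 × ℝ≥0)) (hN : IsMoriHsing θ Ntilde P₁)
    (ZH : Ω₂ → SkorokhodSpace) (hZ : IsProcessZH θ ZH P₂)
    -- `N_n` converges weakly to the limit
    (hconv : TendstoInDistribution (fun n ω => empiricalREPP u X n ω) atTop Ntilde
      (fun _ : ℕ+ => P) P₁) :
    TendstoInDistribution (fun n ω => pathInvPath (empiricalZ u X n ω)) atTop
      (fun ω => pathInvPath (ZH ω).1) (fun _ : ℕ+ => P) P₂ ∧
    ∀ᵐ ω ∂P₂, ∀ y : ℝ≥0, 0 < y → pathInv (ZH ω).1 y ≠ ∞ := by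
  refine ⟨?_, hZ.ae_pathInv_ne_top hθ.1⟩
  have hr : ∀ n, ∀ᵐ ω ∂P, ∀ j, X j ω ∈ range (u n) := fun n => ae_all_iff.2 (hurange n)
  have hanti : ∀ n, ∀ᵐ ω ∂P, Antitone (empiricalZ u X n ω) := fun n =>
    (hr n).mono fun _ => antitone_empiricalZ (huanti n)
  have hlim : ∀ (F : Finset (ℕ × ℕ)) (t y : ℕ × ℕ → ℝ≥0),
      Tendsto (fun n => P.real {ω | ∀ i ∈ F, (y i : ℝ≥0∞) ≤ empiricalZ u X n ω (t i)}) atTop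
        (𝓝 (Real.exp (-θ * stepArea F t y))) := by
    intro F t y
    have hiff : ∀ n, ∀ᵐ ω ∂P,
        (∀ i ∈ F, (y i : ℝ≥0∞) ≤ empiricalZ u X n ω (t i)) ↔ ∀ i ∈ F, ∀ j : ℕ,
          (j : ℝ≥0) / (n : ℕ) ≤ t i → y i ≤ Function.invFun (u n) (X j ω) := fun n => by
      filter_upwards [hr n] with ω hω
      exact forall₂_congr fun i _ => le_empiricalZ_iff (huanti n) hω
    refine tendsto_measureReal_of_tent F t y hconv (hN.measureReal_void hθ.1 F) (fun n => ?_)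
      fun n ε => ?_
    · filter_upwards [hiff n] with ω hω h
      exact integral_tent_timeMark_eq_zero (hω.1 h)
    · filter_upwards [hiff n] with ω hω h
      exact le_integral_tent_timeMark ε fun h' => h (hω.2 h')
  refine TendstoInDistribution.of_comp exists_isOpen_gridValues_preimage
    (fun n ω => pathInvPath_antitone _) (fun ω => pathInvPath_antitone _)
    (tendstoInDistribution_pi_of_tendsto_upperSets
      (fun n => aemeasurable_pi_iff.2 fun p => aemeasurable_pathInvPath (hanti n)
        (nullMeasurableSet_le_empiricalZ hX (huanti n) (hr n)) _)
      (aemeasurable_pi_iff.2 fun p => aemeasurable_pathInvPath hZ.ae_antitone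
        (fun t y => (measurableSet_le measurable_const (hZ.1 t)).nullMeasurableSet) _) ?_)
  intro F U hU
  -- An empty upper set has infimum `∞` and corresponds to no rectangle; in that case all the
  -- probabilities vanish.
  by_cases hne : ∃ i ∈ F, U i = ∅
  · obtain ⟨i, hi, hUi⟩ := hne
    have hnot : ∀ h : ℕ × ℕ → ℝ≥0∞, ¬∀ i ∈ F, h i ∈ U i := fun h hh => by
      simpa [hUi] using hh i hi
    have h1 : P₂.real {ω | ∀ i ∈ F, gridValues (pathInvPath (ZH ω).1) i ∈ U i} = 0 := 
      (congrArg P₂.real (eq_empty_of_forall_notMem fun ω => hnot _)).trans measureReal_empty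
    rw [h1]
    refine tendsto_const_nhds.congr fun n => Eq.symm ?_
    exact (congrArg P.real (eq_empty_of_forall_notMem fun ω => hnot _)).trans measureReal_empty
  · push Not at hne
    have hfin : ∀ i ∈ F, ∃ c : ℝ≥0, (c : ℝ≥0∞) ∈ U i := fun i hi =>
      (hU i).2.resolve_left (hne i hi).ne_empty
    have h1 := tendsto_measureReal_pathInvPath hanti hlim (fun i _ => (hU i).1) hfin
      fun p => p.1 * (1 / (p.2 + 1))
    -- The constant sequence `Z_H` has the same limiting survival functions, so the same lemma
    -- evaluates the probability for its inverse and identifies the limit.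
    have h2 := tendsto_measureReal_pathInvPath (l := (atTop : Filter ℕ))
      (Z := fun _ ω => (ZH ω).1) (fun _ => hZ.ae_antitone)
      (fun F t y => tendsto_const_nhds.congr fun _ => (hZ.measureReal_forall_le F t y).symm)
      (fun i _ => (hU i).1) hfin fun p => p.1 * (1 / (p.2 + 1))
    have h3 := tendsto_nhds_unique h2 tendsto_const_nhds
    rw [h3] at h1
    exact h1

end
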